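/- Let $n\ge 4$ and let $M=I\times_q M^*$ be an $n$-dimensional generalized Robertson–Walker space-time: $I\subseteq\mathbb R$ is an open interval, $q:I\to(0,\infty)$ is smooth, $(M^*,g^*)$ is a smooth Riemannian manifold of dimension $n-1$, and $M=I\times M^*$ carries the Lorentzian metric $g=-dt^2+q(t)^2\,g^*_{\mu\nu}(x)\,dx^\mu dx^\nu$. Assume that $q$ is not constant. Let $u=\partial_t$ (so $u_ku^k=-1$), let $R_{kl}$, $R$ and $C_{jkl}{}^m$ be the Ricci tensor, the curvature scalar and the Weyl tensor of $g$, and write $\dot S=u^m\nabla_mS$ for a scalar $S$. Assume that the Weyl tensor is divergence-free, $\nabla_m C_{jkl}{}^m=0$. Let $f$ be a real function that is smooth on an open set of real numbers containing all values of $R$, let $\kappa\neq 0$, and let $T_{kl}$ be the stress-energy tensor defined by the field equations of $f(R)$ gravity, $$f'(R)R_{kl}-\tfrac12 f(R)g_{kl}+[g_{kl}\nabla^2-\nabla_k\nabla_l]f'(R)=\kappa T_{kl}.$$ Then there are scalars $\varphi,\xi,p,\mu$ such that $\nabla_ku_l=\varphi(g_{kl}+u_ku_l)$, $R_{ij}u^j=\xi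 u_i$, and $T_{kl}$ is the stress-energy tensor of a perfect fluid, $$T_{kl}=(\mu+p)\,u_ku_l+p\,g_{kl},$$ with pressure $p$ and energy density $\mu$ given by $$\kappa p=-\tfrac12 f(R)+\frac{R-\xi}{n-1}f'(R)-\big[(n-2)\varphi\dot R+\ddot R\big]f''(R)-\dot R^2f'''(R),$$ $$\kappa\mu=\tfrac12 f(R)-\xi f'(R)+(n-1)\varphi\dot R f''(R).$$ -/

import Mathlib

open scoped ContDiff Manifold

noncomputable section

namespace GRW

/-! Classical tensor calculus in a coordinate system `y = (y⁰, …, yⁿ⁻¹)`, for a metric given by its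
matrix of components `G y = (g_{ij}(y))`. -/

/-- Coordinate space of dimension `n`. -/
abbrev Coord (n : ℕ) : Type := Fin n → ℝ

/-- The components `g_{ij}` of a metric as functions of the coordinates. -/
abbrev MetricComp (n : ℕ) : Type := Coord n → Matrix (Fin n) (Fin n) ℝ

/-- Partial derivative `∂_i F`. -/
def pd {n : ℕ} (i : Fin n) (F : Coord n → ℝ) (y : Coord n) : ℝ :=
  fderiv ℝ F y (Pi.single i 1)

/-- Christoffel symbols of the Levi-Civita connection,
`Γ^k_{ij} = ½ g^{kl} (∂_i g_{jl} + ∂_j g_{il} - ∂_l g_{ij})`. -/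
def christoffel {n : ℕ} (G : MetricComp n) (k i j : Fin n) (y : Coord n) : ℝ :=
  (1 / 2) * ∑ l, (G y)⁻¹ k l *
    (pd i (fun z => G z j l) y + pd j (fun z => G z i l) y - pd l (fun z => G z i j) y)

/-- The Riemann tensor `R_{jkl}{}^m`, with the convention `[∇_j, ∇_k] X_l = R_{jkl}{}^m X_m`. -/
def riemann {n : ℕ} (G : MetricComp n) (j k l m : Fin n) (y : Coord n) : ℝ :=
  pd k (christoffel G m j l) y - pd j (christoffel G m k l) y
    + ∑ p, (christoffel G m k p y * christoffel G p j l y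
      - christoffel G m j p y * christoffel G p k l y)

/-- The Ricci tensor `R_{kl} = -R_{mkl}{}^m` (positive on round spheres). -/
def ricci {n : ℕ} (G : MetricComp n) (k l : Fin n) (y : Coord n) : ℝ :=
  -∑ m, riemann G m k l m y

/-- The Ricci tensor with one index raised, `R_k{}^m = g^{ml} R_{kl}`. -/
def ricciUp {n : ℕ} (G : MetricComp n) (k m : Fin n) (y : Coord n) : ℝ :=
  ∑ l, (G y)⁻¹ m l * ricci G k l y

/-- The curvature scalar `R = g^{kl} R_{kl}`. -/
def scalar {n : ℕ} (G : MetricComp n) (y : Coord n) : ℝ :=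
  ∑ k, ∑ l, (G y)⁻¹ k l * ricci G k l y

/-- Kronecker's symbol `δ_j{}^m`. -/
def delta {n : ℕ} (j m : Fin n) : ℝ := if j = m then 1 else 0

/-- The Weyl (conformal curvature) tensor `C_{jkl}{}^m` (meaningful for `n ≥ 3`). -/
def weyl {n : ℕ} (G : MetricComp n) (j k l m : Fin n) (y : Coord n) : ℝ :=
  riemann G j k l m y
    + (1 / ((n : ℝ) - 2)) * (delta j m * ricci G k l y - delta k m * ricci G j l y
        + ricciUp G j m y * G y k l - ricciUp G k m y * G y j l)
    - scalar G y / (((n : ℝ) - 1) * ((n : ℝ) - 2)) * (delta j m * G y k l - delta k m * G y j l)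

/-- The divergence `∇_m C_{jkl}{}^m` of the Weyl tensor. -/
def divWeyl {n : ℕ} (G : MetricComp n) (j k l : Fin n) (y : Coord n) : ℝ :=
  ∑ m, (pd m (weyl G j k l m) y
    + ∑ p, (christoffel G m m p y * weyl G j k l p y
      - christoffel G p m j y * weyl G p k l m y
      - christoffel G p m k y * weyl G j p l m y
      - christoffel G p m l y * weyl G j k p m y))

/-- Covariant derivative `∇_k w_l = ∂_k w_l - Γ^p_{kl} w_p` of a covector field. -/
def covD {n : ℕ} (G : MetricComp n) (w : Fin n → Coord n → ℝ) (k l : Fin n) (y : Coord n) : ℝ :=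
  pd k (w l) y - ∑ p, christoffel G p k l y * w p y

/-- The Hessian `∇_k ∇_l S` of a scalar field. -/
def hess {n : ℕ} (G : MetricComp n) (S : Coord n → ℝ) (k l : Fin n) (y : Coord n) : ℝ :=
  covD G (fun i => pd i S) k l y

/-- The d'Alembertian `∇² S = g^{kl} ∇_k ∇_l S`. -/
def box {n : ℕ} (G : MetricComp n) (S : Coord n → ℝ) (y : Coord n) : ℝ :=
  ∑ k, ∑ l, (G y)⁻¹ k l * hess G S k l y

/-- The covector field `u_k = g_{kl} u^l`. -/
def lower {n : ℕ} (G : MetricComp n) (u : Coord n → Fin n → ℝ) (k : Fin n) (y : Coord n) : ℝ :=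
  ∑ l, G y k l * u y l

/-- `Ṡ = u^m ∇_m S`. -/
def dot {n : ℕ} (u : Coord n → Fin n → ℝ) (S : Coord n → ℝ) (y : Coord n) : ℝ :=
  ∑ m, u y m * pd m S y

/-- The stress-energy tensor `T_{kl}` defined by the field equations of `f(R)` gravity,
`f'(R) R_{kl} - ½ f(R) g_{kl} + [g_{kl} ∇² - ∇_k ∇_l] f'(R) = κ T_{kl}`. -/
def stressEnergy {n : ℕ} (κ : ℝ) (f : ℝ → ℝ) (G : MetricComp n) (k l : Fin n) (y : Coord n) : ℝ :=
  κ⁻¹ * (deriv f (scalar G y) * ricci G k l y - (1 / 2) * f (scalar G y) * G y k l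
    + (G y k l * box G (fun z => deriv f (scalar G z)) y
      - hess G (fun z => deriv f (scalar G z)) k l y))

/-! Generalized Robertson-Walker space-times. -/

/-- The data of a generalized Robertson-Walker space-time `I ×_q S` of dimension `m + 1`: an open
interval `I`, a smooth positive function `q` on it, and a smooth Riemannian metric on the
`m`-dimensional manifold `S`. The space-time is `I × S` with the Lorentzian metric
`-dt² + q(t)² g*`. -/
structure SpaceTime (m : ℕ) (S : Type*) [TopologicalSpace S]
    [ChartedSpace (EuclideanSpace ℝ (Fin m)) S] [IsManifold (𝓡 m) ∞ S] where
  /-- the time interval -/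
  I : Set ℝ
  isOpen_I : IsOpen I
  ordConnected_I : I.OrdConnected
  /-- the warping function (scale factor) -/
  q : ℝ → ℝ
  contDiffOn_q : ContDiffOn ℝ ∞ q I
  q_pos : ∀ t ∈ I, 0 < q t
  /-- the Riemannian metric `g*` of the fibre -/
  fibre : Bundle.ContMDiffRiemannianMetric (𝓡 m) ∞ (EuclideanSpace ℝ (Fin m))
    (fun x : S => TangentSpace (𝓡 m) x)

namespace SpaceTime

variable {m : ℕ} {S : Type*} [TopologicalSpace S]
    [ChartedSpace (EuclideanSpace ℝ (Fin m)) S] [IsManifold (𝓡 m) ∞ S]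

/-- The space coordinates `(y¹, …, yᵐ)` of `y = (t, y¹, …, yᵐ)`. -/
def spacePart (y : Coord (m + 1)) : EuclideanSpace ℝ (Fin m) := WithLp.toLp 2 (Fin.tail y)

/-- The components `g*_{μν} = g*(∂_μ, ∂_ν)` of the fibre metric in the chart `e` of `S`, at the
point with coordinates `x`. -/
def fibreComp (M : SpaceTime m S) (e : OpenPartialHomeomorph S (EuclideanSpace ℝ (Fin m)))
    (x : EuclideanSpace ℝ (Fin m)) (μ ν : Fin m) : ℝ :=
  M.fibre.inner (e.symm x)
    (mfderiv 𝓘(ℝ, EuclideanSpace ℝ (Fin m)) (𝓡 m) e.symm x (EuclideanSpace.single μ (1 : ℝ)))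
    (mfderiv 𝓘(ℝ, EuclideanSpace ℝ (Fin m)) (𝓡 m) e.symm x (EuclideanSpace.single ν (1 : ℝ)))

/-- The components of the space-time metric `-dt² + q(t)² g*_{μν}(x) dx^μ dx^ν` in the coordinates
`y = (t, x)` of `I × S` obtained from the chart `e` of `S`. -/
def metric (M : SpaceTime m S) (e : OpenPartialHomeomorph S (EuclideanSpace ℝ (Fin m))) :
    MetricComp (m + 1) := fun y =>
  Matrix.of (Fin.cons (Fin.cons (-1) (fun _ => 0))
    (fun μ => Fin.cons 0 (fun ν => M.q (y 0) ^ 2 * M.fibreComp e (spacePart y) μ ν)))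

/-- The range of the coordinates `y = (t, x)` obtained from the chart `e` of `S`. -/
def domain (M : SpaceTime m S) (e : OpenPartialHomeomorph S (EuclideanSpace ℝ (Fin m))) :
    Set (Coord (m + 1)) :=
  {y | y 0 ∈ M.I ∧ spacePart y ∈ e.target}

/-- The smooth charts of the fibre; the coordinate systems `(t, x)` they give cover `I × S`. -/
def charts (_M : SpaceTime m S) :
    Set (OpenPartialHomeomorph S (EuclideanSpace ℝ (Fin m))) :=
  IsManifold.maximalAtlas (𝓡 m) ∞ S

/-- The time-like unit vector field `u = ∂_t`, that is `u⁰ = 1`, `u^μ = 0`. -/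
def velocity (_M : SpaceTime m S) (_y : Coord (m + 1)) : Fin (m + 1) → ℝ := Pi.single 0 1

/-- The Weyl tensor is divergence-free: `∇_m C_{jkl}{}^m = 0` everywhere. -/
def HarmonicWeyl (M : SpaceTime m S) : Prop :=
  ∀ e ∈ M.charts, ∀ y ∈ M.domain e, ∀ j k l, divWeyl (M.metric e) j k l y = 0

end SpaceTime

end GRW

end

noncomputable section

namespace GRW

/-! ### The fibre metric in charts: smoothness and nondegeneracy -/

namespace SpaceTime

variable {m : ℕ} {S : Type*} [TopologicalSpace S]
    [ChartedSpace (EuclideanSpace ℝ (Fin m)) S] [IsManifold (𝓡 m) ∞ S]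

/-! Write m = n - 1, h for the fibre metric in a chart and φ = q'/q. In coordinates (t, x) the
metric is block diagonal, so Christoffel symbols and curvature are explicit in q, h and the
curvature of h. For every such warped product, ∇u = φ (g + u ⊗ u) and u is a Ricci eigenvector with
ξ = m q''/q.

The Weyl hypothesis enters through the components (0, μ, ν) of the divergence. There C_{0μν}{}^0 =
E_{μν}/(m - 1), where E is the trace-free Ricci tensor of h and does not involve t, and the
divergence equals (m - 2)/(m - 1) · φ · E_{μν} (`divWeyl_zero_succ_succ`). A nonconstant q has q' ≠
0 at some instant. Evaluating there gives E = 0 at every x, so the fibre is Einstein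
(`ricci_fibre_eq`).

As m ≥ 3, Schur's lemma (`pd_scalar_eq_zero_of_einstein`, from the contracted Bianchi identity
`pd_scalar`) kills the spatial derivatives of the fibre's curvature scalar. Hence those of R vanish
too (`pd_succ_scalar_eq_zero`), by the formula `scalar_eq` for R.

Now the Ricci tensor is -ξ in the time direction and (R - ξ)/m times g on the slices. The Hessian of
f'(R), a scalar with no spatial gradient, also combines only u ⊗ u and g. So every term of the field
equations has perfect-fluid form, and `stressEnergy_eq` reads off pressure and density with the
chain rule for f'(R). -/

theorem contMDiffOn_tangent_symm {e : OpenPartialHomeomorph S (EuclideanSpace ℝ (Fin m))}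
    (he : e ∈ IsManifold.maximalAtlas (𝓡 m) ∞ S) (c : EuclideanSpace ℝ (Fin m)) :
    ContMDiffOn 𝓘(ℝ, EuclideanSpace ℝ (Fin m)) (𝓡 m).tangent ∞
      (fun x => (Bundle.TotalSpace.mk' (EuclideanSpace ℝ (Fin m)) (e.symm x)
        (mfderiv 𝓘(ℝ, EuclideanSpace ℝ (Fin m)) (𝓡 m) e.symm x c) :
          TangentBundle (𝓡 m) S)) e.target := by
  have h1 := contMDiffOn_symm_of_mem_maximalAtlas he
  have h2 := h1.contMDiffOn_tangentMapWithin (m := ∞) (by simp) e.open_target.uniqueMDiffOn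
  -- The coordinate field is the tangent map of the inverse chart composed with the constant section
  -- `c` of the tangent bundle of the model space.
  have h3 : ContMDiff 𝓘(ℝ, EuclideanSpace ℝ (Fin m))
      (𝓘(ℝ, EuclideanSpace ℝ (Fin m))).tangent ∞
      (fun x => (Bundle.TotalSpace.mk' (EuclideanSpace ℝ (Fin m)) x c :
        TangentBundle 𝓘(ℝ, EuclideanSpace ℝ (Fin m)) (EuclideanSpace ℝ (Fin m)))) := by
    intro x
    refine Bundle.contMDiffAt_section x |>.2 ?_
    simpa using contMDiffAt_const
  refine (h2.comp h3.contMDiffOn (fun x hx => hx)).congr fun x hx => ?_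
  simp only [Function.comp, tangentMapWithin]
  rw [mfderivWithin_of_isOpen e.open_target hx]

theorem contDiffOn_fibreComp (M : SpaceTime m S)
    {e : OpenPartialHomeomorph S (EuclideanSpace ℝ (Fin m))} (he : e ∈ M.charts) (μ ν : Fin m) :
    ContDiffOn ℝ ∞ (fun x => M.fibreComp e x μ ν) e.target := by
  have h := ContMDiffOn.clm_bundle_apply₂
    (F₁ := EuclideanSpace ℝ (Fin m)) (F₂ := EuclideanSpace ℝ (Fin m)) (F₃ := ℝ)
    (E₁ := fun x : S => TangentSpace (𝓡 m) x) (E₂ := fun x : S => TangentSpace (𝓡 m) x)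
    (E₃ := fun _ : S => ℝ)
    (M.fibre.contMDiff.comp_contMDiffOn (contMDiffOn_symm_of_mem_maximalAtlas he))
    (contMDiffOn_tangent_symm he (EuclideanSpace.single μ (1 : ℝ)))
    (contMDiffOn_tangent_symm he (EuclideanSpace.single ν (1 : ℝ)))
  rw [← contMDiffOn_iff_contDiffOn]
  intro x hx
  have := (Bundle.contMDiffWithinAt_totalSpace.1 (h x hx)).2
  simp only [Bundle.Trivial.trivialization_apply, Bundle.Trivial.fiberBundle_trivializationAt'] at this
  exact this

theorem fibreComp_symm (M : SpaceTime m S)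
    (e : OpenPartialHomeomorph S (EuclideanSpace ℝ (Fin m))) (x) (μ ν : Fin m) :
    M.fibreComp e x μ ν = M.fibreComp e x ν μ :=
  M.fibre.symm _ _ _

/-- A Gram matrix: the differential of the inverse chart is injective, so a kernel vector would give
a nonzero tangent vector of zero length, against positive definiteness. -/
theorem det_fibreComp_ne_zero (M : SpaceTime m S)
    {e : OpenPartialHomeomorph S (EuclideanSpace ℝ (Fin m))} (he : e ∈ M.charts)
    {x : EuclideanSpace ℝ (Fin m)} (hx : x ∈ e.target) :
    (Matrix.of (M.fibreComp e x)).det ≠ 0 := by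
  have hd : OpenPartialHomeomorph.MDifferentiable (𝓡 m) 𝓘(ℝ, EuclideanSpace ℝ (Fin m)) e :=
    ⟨(contMDiffOn_of_mem_maximalAtlas he).mdifferentiableOn (by simp),
      (contMDiffOn_symm_of_mem_maximalAtlas he).mdifferentiableOn (by simp)⟩
  have hinj := hd.symm.mfderiv_injective hx
  set L := mfderiv 𝓘(ℝ, EuclideanSpace ℝ (Fin m)) (𝓡 m) e.symm x with hL
  intro h0
  obtain ⟨v, hv, hv0⟩ := Matrix.exists_mulVec_eq_zero_iff.2 h0
  let w : EuclideanSpace ℝ (Fin m) := ∑ i, v i • EuclideanSpace.single i (1 : ℝ)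
  have hw : w ≠ 0 := by
    intro h
    apply hv
    ext j
    have := congrArg (fun z : EuclideanSpace ℝ (Fin m) => z j) h
    simpa [w, Pi.single_apply] using this
  have hLw : L w ≠ 0 := fun h => hw (hinj (by rw [h]; exact (map_zero L).symm))
  have hpos := M.fibre.pos (e.symm x) (L w) hLw
  have hLe : L w = ∑ i, v i • L (EuclideanSpace.single i (1 : ℝ)) := by
    simp only [w]
    exact (map_sum L _ _).trans (Finset.sum_congr rfl fun i _ => map_smul L _ _)
  rw [hLe] at hpos
  apply hpos.ne'
  set B := M.fibre.inner (e.symm x)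
  have hB (z) : B (∑ i, v i • L (EuclideanSpace.single i (1 : ℝ))) z
      = ∑ i, v i * B (L (EuclideanSpace.single i (1 : ℝ))) z := by
    have h := congrArg (fun l => l z) (map_sum B (fun i =>
      v i • L (EuclideanSpace.single i (1 : ℝ))) Finset.univ)
    refine h.trans ((sum_apply _ _ _).trans (Finset.sum_congr rfl fun i _ => ?_))
    exact congrArg (fun l => l z) (map_smul B (v i) _)
  have hB' (z) : B z (∑ i, v i • L (EuclideanSpace.single i (1 : ℝ)))
      = ∑ i, v i * B z (L (EuclideanSpace.single i (1 : ℝ))) :=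
    (map_sum (B z) _ _).trans (Finset.sum_congr rfl fun i _ => map_smul (B z) (v i) _)
  rw [hB]
  refine Finset.sum_eq_zero fun i _ => ?_
  rw [hB', mul_eq_zero]
  refine Or.inr (Eq.trans (Finset.sum_congr rfl fun j _ => mul_comm _ _) (congrFun hv0 i))

end SpaceTime

/-! ### Rules for partial derivatives on open sets -/

section PartialDerivatives

variable {n : ℕ} {D : Set (Coord n)} {F F' : Coord n → ℝ} {y : Coord n}

theorem differentiableAt_of_contDiffOn (hD : IsOpen D) (hF : ContDiffOn ℝ ∞ F D) (hy : y ∈ D) :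
    DifferentiableAt ℝ F y :=
  (hF.contDiffAt (hD.mem_nhds hy)).differentiableAt (by simp)

theorem pd_congr (hD : IsOpen D) (hy : y ∈ D) (h : ∀ z ∈ D, F z = F' z) (i : Fin n) :
    pd i F y = pd i F' y := by
  have : F =ᶠ[nhds y] F' := Filter.eventually_of_mem (hD.mem_nhds hy) h
  rw [pd, pd, this.fderiv_eq]

theorem pd_const (i : Fin n) (c : ℝ) (y : Coord n) : pd i (fun _ => c) y = 0 := by
  simp [pd]

theorem pd_add (i : Fin n) (hF : DifferentiableAt ℝ F y) (hF' : DifferentiableAt ℝ F' y) :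
    pd i (fun z => F z + F' z) y = pd i F y + pd i F' y := by
  simp [pd, fderiv_fun_add hF hF']

theorem pd_sub (i : Fin n) (hF : DifferentiableAt ℝ F y) (hF' : DifferentiableAt ℝ F' y) :
    pd i (fun z => F z - F' z) y = pd i F y - pd i F' y := by
  simp [pd, fderiv_fun_sub hF hF']

theorem pd_neg (i : Fin n) : pd i (fun z => -F z) y = -pd i F y := by
  simp [pd, fderiv_fun_neg]

theorem pd_mul (i : Fin n) (hF : DifferentiableAt ℝ F y) (hF' : DifferentiableAt ℝ F' y) :
    pd i (fun z => F z * F' z) y = pd i F y * F' y + F y * pd i F' y := by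
  simp [pd, fderiv_fun_mul hF hF']
  ring

theorem pd_sum {ι : Type*} (s : Finset ι) (i : Fin n) {H : ι → Coord n → ℝ}
    (hH : ∀ a ∈ s, DifferentiableAt ℝ (H a) y) :
    pd i (fun z => ∑ a ∈ s, H a z) y = ∑ a ∈ s, pd i (H a) y := by
  simp [pd, fderiv_fun_sum hH]

theorem ContDiffOn.pd (hD : IsOpen D) (hF : ContDiffOn ℝ ∞ F D) (i : Fin n) :
    ContDiffOn ℝ ∞ (GRW.pd i F) D :=
  (hF.fderiv_of_isOpen hD (m := ∞) (by simp)).clm_apply contDiffOn_const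

theorem pd_comm (hD : IsOpen D) (hF : ContDiffOn ℝ ∞ F D) (hy : y ∈ D) (i j : Fin n) :
    pd i (pd j F) y = pd j (pd i F) y := by
  have hc := hF.contDiffAt (hD.mem_nhds hy)
  have hs : IsSymmSndFDerivAt ℝ F y := hc.isSymmSndFDerivAt (by
    simp only [minSmoothness_of_isRCLikeNormedField]
    exact WithTop.coe_le_coe.2 (le_top (a := (2 : ℕ∞))))
  have hd : DifferentiableAt ℝ (fderiv ℝ F) y :=
    (hc.fderiv_right (m := ∞) (by simp)).differentiableAt (by simp)
  have key (a b : Fin n) : pd a (pd b F) y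
      = fderiv ℝ (fderiv ℝ F) y (Pi.single a 1) (Pi.single b 1) := by
    unfold pd
    rw [fderiv_clm_apply hd (differentiableAt_const _)]
    simp
  rw [key, key, hs]

end PartialDerivatives

/-! ### Entrywise calculus of matrix-valued functions -/

section MatrixCalculus

variable {n : ℕ} {D : Set (Coord n)} {A B : MetricComp n} {y : Coord n}

/-- Smoothness of a matrix-valued function, entry by entry. -/
def SmoothMat (D : Set (Coord n)) (A : MetricComp n) : Prop :=
  ∀ a b, ContDiffOn ℝ ∞ (fun z => A z a b) D

/-- Partial derivative of a matrix-valued function, entry by entry. -/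
def pdMat (i : Fin n) (A : MetricComp n) : MetricComp n :=
  fun y => Matrix.of fun a b => pd i (fun z => A z a b) y

theorem SmoothMat.add (hA : SmoothMat D A) (hB : SmoothMat D B) :
    SmoothMat D (fun z => A z + B z) := fun a b => (hA a b).add (hB a b)

theorem SmoothMat.sub (hA : SmoothMat D A) (hB : SmoothMat D B) :
    SmoothMat D (fun z => A z - B z) := fun a b => (hA a b).sub (hB a b)

theorem SmoothMat.mul (hA : SmoothMat D A) (hB : SmoothMat D B) :
    SmoothMat D (fun z => A z * B z) := fun a b => by
  simp only [Matrix.mul_apply]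
  exact ContDiffOn.sum fun p _ => (hA a p).mul (hB p b)

theorem SmoothMat.transpose (hA : SmoothMat D A) : SmoothMat D (fun z => (A z).transpose) :=
  fun a b => hA b a

theorem SmoothMat.pdMat (hD : IsOpen D) (hA : SmoothMat D A) (i : Fin n) :
    SmoothMat D (pdMat i A) := fun a b => ContDiffOn.pd hD (hA a b) i

theorem SmoothMat.det (hA : SmoothMat D A) : ContDiffOn ℝ ∞ (fun z => (A z).det) D := by
  simp only [Matrix.det_apply]
  exact ContDiffOn.sum fun σ _ => by
    simp only [Units.smul_def, zsmul_eq_mul]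
    exact contDiffOn_const.mul (contDiffOn_prod fun i _ => hA _ _)

theorem SmoothMat.inv (hA : SmoothMat D A) (hd : ∀ z ∈ D, (A z).det ≠ 0) :
    SmoothMat D (fun z => (A z)⁻¹) := fun a b => by
  simp only [Matrix.inv_def, Matrix.smul_apply, smul_eq_mul, Ring.inverse_eq_inv',
    Matrix.adjugate_apply]
  -- Cramer's rule: an adjugate entry is the determinant of the matrix with one row replaced by
  -- constants.
  refine (hA.det.inv hd).mul (SmoothMat.det fun c d => ?_)
  simp only [Matrix.updateRow_apply]
  split_ifs
  · exact contDiffOn_const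
  · exact hA c d

theorem pdMat_congr (hD : IsOpen D) (hy : y ∈ D) (h : ∀ z ∈ D, A z = B z) (i : Fin n) :
    pdMat i A y = pdMat i B y := by
  ext a b
  exact pd_congr hD hy (fun z hz => by rw [h z hz]) i

theorem pdMat_add (hD : IsOpen D) (hy : y ∈ D) (hA : SmoothMat D A) (hB : SmoothMat D B)
    (i : Fin n) : pdMat i (fun z => A z + B z) y = pdMat i A y + pdMat i B y := by
  ext a b
  exact pd_add i (differentiableAt_of_contDiffOn hD (hA a b) hy)
    (differentiableAt_of_contDiffOn hD (hB a b) hy)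

theorem pdMat_sub (hD : IsOpen D) (hy : y ∈ D) (hA : SmoothMat D A) (hB : SmoothMat D B)
    (i : Fin n) : pdMat i (fun z => A z - B z) y = pdMat i A y - pdMat i B y := by
  ext a b
  exact pd_sub i (differentiableAt_of_contDiffOn hD (hA a b) hy)
    (differentiableAt_of_contDiffOn hD (hB a b) hy)

theorem pdMat_mul (hD : IsOpen D) (hy : y ∈ D) (hA : SmoothMat D A) (hB : SmoothMat D B)
    (i : Fin n) : pdMat i (fun z => A z * B z) y = pdMat i A y * B y + A y * pdMat i B y := by
  have hA' a b := differentiableAt_of_contDiffOn hD (hA a b) hy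
  have hB' a b := differentiableAt_of_contDiffOn hD (hB a b) hy
  ext a b
  simp only [pdMat, Matrix.mul_apply, Matrix.add_apply, Matrix.of_apply]
  rw [pd_sum (H := fun p z => A z a p * B z p b) _ _ fun p _ => (hA' a p).mul (hB' p b),
    ← Finset.sum_add_distrib]
  exact Finset.sum_congr rfl fun p _ => pd_mul i (hA' a p) (hB' p b)

theorem pdMat_transpose (i : Fin n) :
    pdMat i (fun z => (A z).transpose) y = (pdMat i A y).transpose := rfl

theorem pdMat_comm (hD : IsOpen D) (hy : y ∈ D) (hA : SmoothMat D A) (i j : Fin n) :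
    pdMat i (pdMat j A) y = pdMat j (pdMat i A) y := by
  ext a b
  exact pd_comm hD (hA a b) hy i j

end MatrixCalculus

/-! ### Levi-Civita connection, Bianchi identities and Schur's lemma -/

section Bianchi

variable {n : ℕ}

/-- A smooth nondegenerate symmetric matrix of metric components on an open set. -/
structure IsMetricOn (G : MetricComp n) (D : Set (Coord n)) : Prop where
  isOpen : IsOpen D
  smooth : SmoothMat D G
  symm : ∀ y i j, G y i j = G y j i
  det_ne_zero : ∀ y ∈ D, (G y).det ≠ 0

/-- The matrix of connection coefficients `(A_k)^m_l = Γ^m_{kl}`. -/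
def connMat (G : MetricComp n) (k : Fin n) : MetricComp n :=
  fun y => Matrix.of fun m l => christoffel G m k l y

/-- The curvature matrix `F_{jk} = ∂_j A_k - ∂_k A_j + [A_j, A_k]`. -/
def curvMat (G : MetricComp n) (j k : Fin n) : MetricComp n := fun y =>
  pdMat j (connMat G k) y - pdMat k (connMat G j) y
    + (connMat G j y * connMat G k y - connMat G k y * connMat G j y)

theorem riemann_eq_curvMat (G : MetricComp n) (j k l m : Fin n) (y : Coord n) :
    riemann G j k l m y = curvMat G k j y m l := by
  simp [riemann, curvMat, pdMat, connMat, Matrix.mul_apply]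

theorem curvMat_swap (G : MetricComp n) (j k : Fin n) (y : Coord n) :
    curvMat G j k y = -curvMat G k j y := by
  simp only [curvMat]
  abel

theorem ricci_eq_sum_curvMat (G : MetricComp n) (k l : Fin n) (y : Coord n) :
    ricci G k l y = ∑ m, curvMat G m k y m l := by
  simp only [ricci, riemann_eq_curvMat, ← Finset.sum_neg_distrib]
  refine Finset.sum_congr rfl fun m _ => ?_
  rw [curvMat_swap G m k]
  rfl

namespace IsMetricOn

variable {G : MetricComp n} {D : Set (Coord n)} (hG : IsMetricOn G D) {y : Coord n}

include hG

theorem transpose_eq (y : Coord n) : (G y).transpose = G y :=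
  Matrix.ext fun i j => hG.symm y j i

theorem inv_symm (y : Coord n) (i j : Fin n) : (G y)⁻¹ i j = (G y)⁻¹ j i := by
  rw [← Matrix.transpose_apply (G y)⁻¹, Matrix.transpose_nonsing_inv, hG.transpose_eq]

theorem mul_inv (hy : y ∈ D) : G y * (G y)⁻¹ = 1 :=
  Matrix.mul_nonsing_inv _ (hG.det_ne_zero y hy).isUnit

theorem inv_mul (hy : y ∈ D) : (G y)⁻¹ * G y = 1 :=
  Matrix.nonsing_inv_mul _ (hG.det_ne_zero y hy).isUnit

theorem smooth_inv : SmoothMat D fun z => (G z)⁻¹ := hG.smooth.inv hG.det_ne_zero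

theorem christoffel_symm (k i j : Fin n) (y : Coord n) :
    christoffel G k i j y = christoffel G k j i y := by
  simp only [christoffel]
  congr 1
  refine Finset.sum_congr rfl fun l _ => ?_
  rw [show (fun z => G z i j) = fun z => G z j i from funext fun z => hG.symm z i j]
  ring

theorem smooth_christoffel (k i j : Fin n) : ContDiffOn ℝ ∞ (christoffel G k i j) D := by
  refine contDiffOn_const.mul (ContDiffOn.sum fun l _ => (hG.smooth_inv k l).mul ?_)
  exact ((ContDiffOn.pd hG.isOpen (hG.smooth _ _) _).add
    (ContDiffOn.pd hG.isOpen (hG.smooth _ _) _)).sub (ContDiffOn.pd hG.isOpen (hG.smooth _ _) _)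

theorem smooth_connMat (k : Fin n) : SmoothMat D (connMat G k) :=
  fun _ _ => hG.smooth_christoffel _ _ _

theorem smooth_curvMat (j k : Fin n) : SmoothMat D (curvMat G j k) :=
  (((hG.smooth_connMat k).pdMat hG.isOpen j).sub ((hG.smooth_connMat j).pdMat hG.isOpen k)).add
    (((hG.smooth_connMat j).mul (hG.smooth_connMat k)).sub
      ((hG.smooth_connMat k).mul (hG.smooth_connMat j)))

theorem smooth_ricci (k l : Fin n) : ContDiffOn ℝ ∞ (ricci G k l) D := by
  have : ricci G k l = fun y => ∑ m, curvMat G m k y m l :=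
    funext fun y => ricci_eq_sum_curvMat G k l y
  rw [this]
  exact ContDiffOn.sum fun m _ => hG.smooth_curvMat m k m l

theorem smooth_scalar : ContDiffOn ℝ ∞ (scalar G) D :=
  ContDiffOn.sum fun k _ => ContDiffOn.sum fun l _ =>
    (hG.smooth_inv k l).mul (hG.smooth_ricci k l)

theorem smooth_ricciUp (k l : Fin n) : ContDiffOn ℝ ∞ (ricciUp G k l) D :=
  ContDiffOn.sum fun p _ => (hG.smooth_inv l p).mul (hG.smooth_ricci k p)

/-- Christoffel symbols of the first kind. -/
theorem lower_christoffel (hy : y ∈ D) (a k l : Fin n) :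
    ∑ m, G y a m * christoffel G m k l y = (1 / 2) * (pd k (fun z => G z l a) y
      + pd l (fun z => G z k a) y - pd a (fun z => G z k l) y) := by
  have h := congrFun (congrArg (fun N : Matrix (Fin n) (Fin n) ℝ => N.mulVec fun a =>
    (1 / 2) * (pd k (fun z => G z l a) y + pd l (fun z => G z k a) y
      - pd a (fun z => G z k l) y)) (hG.mul_inv hy)) a
  simp only [Matrix.one_mulVec, ← Matrix.mulVec_mulVec] at h
  rw [← h]
  simp only [Matrix.mulVec, dotProduct, christoffel, Finset.mul_sum]
  refine Finset.sum_congr rfl fun p _ => Finset.sum_congr rfl fun q _ => ?_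
  ring

/-- The Levi-Civita connection is compatible with the metric. -/
theorem pd_metric (hy : y ∈ D) (k a b : Fin n) : pd k (fun z => G z a b) y
    = ∑ m, G y a m * christoffel G m k b y + ∑ m, G y b m * christoffel G m k a y := by
  rw [hG.lower_christoffel hy, hG.lower_christoffel hy]
  have h (a b) : (fun z => G z a b) = fun z => G z b a := funext fun z => hG.symm z a b
  rw [h b a, h k a, h k b]
  ring

theorem pdMat_metric (hy : y ∈ D) (k : Fin n) :
    pdMat k G y = G y * connMat G k y + (connMat G k y).transpose * G y := by
  ext a b
  simp only [pdMat, Matrix.of_apply, Matrix.add_apply, Matrix.mul_apply, Matrix.transpose_apply,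
    connMat]
  rw [hG.pd_metric hy]
  congr 1
  exact Finset.sum_congr rfl fun p _ => by rw [hG.symm, mul_comm]

theorem pdMat_pdMat_metric (hy : y ∈ D) (j k : Fin n) :
    pdMat j (pdMat k G) y
      = (G y * connMat G j y + (connMat G j y).transpose * G y) * connMat G k y
        + G y * pdMat j (connMat G k) y + ((pdMat j (connMat G k) y).transpose * G y
        + (connMat G k y).transpose
          * (G y * connMat G j y + (connMat G j y).transpose * G y)) := by
  have hA := hG.smooth_connMat
  rw [pdMat_congr hG.isOpen hy (fun z hz => hG.pdMat_metric hz k) j,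
    pdMat_add hG.isOpen hy (hG.smooth.mul (hA k)) ((hA k).transpose.mul hG.smooth),
    pdMat_mul hG.isOpen hy hG.smooth (hA k), pdMat_mul hG.isOpen hy (hA k).transpose hG.smooth,
    pdMat_transpose, hG.pdMat_metric hy]

/-- The curvature is skew with respect to the metric. -/
theorem metric_mul_curvMat (hy : y ∈ D) (j k : Fin n) :
    G y * curvMat G j k y + (curvMat G j k y).transpose * G y = 0 := by
  -- Second derivatives of the metric commute. Expressed through the connection, their difference is
  -- exactly the claimed combination of curvature matrices.
  have h := pdMat_comm hG.isOpen hy hG.smooth j k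
  rw [hG.pdMat_pdMat_metric hy, hG.pdMat_pdMat_metric hy, ← sub_eq_zero] at h
  rw [← h]
  simp only [curvMat, Matrix.transpose_add, Matrix.transpose_sub, Matrix.transpose_mul]
  noncomm_ring

/-- Differentiate G⁻¹ G = 1 and insert metric compatibility; this says that the inverse metric is
covariantly constant. -/
theorem pdMat_inv (hy : y ∈ D) (k : Fin n) : pdMat k (fun z => (G z)⁻¹) y
    = -(connMat G k y * (G y)⁻¹ + (G y)⁻¹ * (connMat G k y).transpose) := by
  have h1 : pdMat k (fun z => (G z)⁻¹ * G z) y = 0 := by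
    rw [pdMat_congr hG.isOpen hy (fun z hz => hG.inv_mul hz)]
    ext a b
    exact pd_const _ _ _
  rw [pdMat_mul hG.isOpen hy hG.smooth_inv hG.smooth, hG.pdMat_metric hy] at h1
  have h2 := congrArg (· * (G y)⁻¹) h1
  simp only [add_mul, mul_add, Matrix.mul_assoc, hG.mul_inv hy, mul_one, zero_mul] at h2
  rw [← Matrix.mul_assoc (G y)⁻¹ (G y), hG.inv_mul hy, one_mul] at h2
  rw [eq_neg_iff_add_eq_zero, ← h2]

/-- The second Bianchi identity. -/
theorem bianchi (hy : y ∈ D) (i j k : Fin n) :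
    (pdMat i (curvMat G j k) y + connMat G i y * curvMat G j k y
        - curvMat G j k y * connMat G i y)
      + (pdMat j (curvMat G k i) y + connMat G j y * curvMat G k i y
        - curvMat G k i y * connMat G j y)
      + (pdMat k (curvMat G i j) y + connMat G k y * curvMat G i j y
        - curvMat G i j y * connMat G k y) = 0 := by
  have hA := hG.smooth_connMat
  -- Only matrix-index connection terms appear in the identity: those for the form indices cancel
  -- cyclically by torsion-freeness. After expansion, second derivatives cancel in pairs and the
  -- cubic terms by the Jacobi identity.
  have hd (i j k : Fin n) : pdMat i (curvMat G j k) y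
      = pdMat i (pdMat j (connMat G k)) y - pdMat i (pdMat k (connMat G j)) y
        + (pdMat i (connMat G j) y * connMat G k y + connMat G j y * pdMat i (connMat G k) y
        - (pdMat i (connMat G k) y * connMat G j y
          + connMat G k y * pdMat i (connMat G j) y)) := by
    have hO := hG.isOpen
    change pdMat i (fun z => (pdMat j (connMat G k) z - pdMat k (connMat G j) z)
      + (connMat G j z * connMat G k z - connMat G k z * connMat G j z)) y = _
    rw [pdMat_add hO hy (((hA k).pdMat hO j).sub ((hA j).pdMat hO k))
      (((hA j).mul (hA k)).sub ((hA k).mul (hA j))),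
      pdMat_sub hO hy ((hA k).pdMat hO j) ((hA j).pdMat hO k),
      pdMat_sub hO hy ((hA j).mul (hA k)) ((hA k).mul (hA j)),
      pdMat_mul hO hy (hA j) (hA k), pdMat_mul hO hy (hA k) (hA j)]
  rw [hd i j k, hd j k i, hd k i j, pdMat_comm hG.isOpen hy (hA k) j i,
    pdMat_comm hG.isOpen hy (hA j) i k, pdMat_comm hG.isOpen hy (hA i) k j]
  simp only [curvMat]
  noncomm_ring

omit hG in
/-- The curvature matrix with both matrix indices raised, `R_{jk}{}^{ab}`. -/
def _root_.GRW.curvUp (G : MetricComp n) (j k : Fin n) : MetricComp n :=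
  fun y => curvMat G j k y * (G y)⁻¹

omit hG in
theorem curvUp_swap (j k a b : Fin n) : curvUp G j k y a b = -curvUp G k j y a b := by
  rw [curvUp, curvUp, curvMat_swap G j k, Matrix.neg_mul, Matrix.neg_apply]

theorem curvUp_skew (hy : y ∈ D) (j k a b : Fin n) :
    curvUp G j k y a b = -curvUp G j k y b a := by
  have h := congrArg (fun N => (G y)⁻¹ * N * (G y)⁻¹) (hG.metric_mul_curvMat hy j k)
  simp only [mul_add, add_mul, Matrix.mul_assoc, hG.mul_inv hy, mul_one, mul_zero, zero_mul] at h
  rw [← Matrix.mul_assoc (G y)⁻¹ (G y), hG.inv_mul hy, one_mul] at h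
  have h' : curvUp G j k y + (curvUp G j k y).transpose = 0 := by
    rw [← h, curvUp, Matrix.transpose_mul, Matrix.transpose_nonsing_inv, hG.transpose_eq]
  exact eq_neg_of_add_eq_zero_left (congrFun (congrFun h' a) b)

theorem smooth_curvUp (j k : Fin n) : SmoothMat D (curvUp G j k) :=
  (hG.smooth_curvMat j k).mul hG.smooth_inv

/-- Since G⁻¹ is covariantly constant, it passes through the derivative in `bianchi`. With both
matrix indices up, two contractions need no further metric factor. -/
theorem bianchi_curvUp (hy : y ∈ D) (i j k : Fin n) :
    (pdMat i (curvUp G j k) y + connMat G i y * curvUp G j k y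
        + curvUp G j k y * (connMat G i y).transpose)
      + (pdMat j (curvUp G k i) y + connMat G j y * curvUp G k i y
        + curvUp G k i y * (connMat G j y).transpose)
      + (pdMat k (curvUp G i j) y + connMat G k y * curvUp G i j y
        + curvUp G i j y * (connMat G k y).transpose) = 0 := by
  have h (i j k : Fin n) : pdMat i (curvUp G j k) y + connMat G i y * curvUp G j k y
      + curvUp G j k y * (connMat G i y).transpose
      = (pdMat i (curvMat G j k) y + connMat G i y * curvMat G j k y
        - curvMat G j k y * connMat G i y) * (G y)⁻¹ := by
    have hd : pdMat i (curvUp G j k) y = _ :=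
      pdMat_mul hG.isOpen hy (hG.smooth_curvMat j k) hG.smooth_inv i
    rw [hd, hG.pdMat_inv hy]
    simp only [curvUp]
    noncomm_ring
  rw [h, h, h, ← add_mul, ← add_mul, hG.bianchi hy, zero_mul]

theorem ricciUp_eq_sum_curvUp (k b : Fin n) (y : Coord n) :
    ricciUp G k b y = ∑ m, curvUp G m k y m b := by
  simp only [ricciUp, ricci_eq_sum_curvMat, curvUp, Matrix.mul_apply, Finset.mul_sum]
  rw [Finset.sum_comm]
  refine Finset.sum_congr rfl fun m _ => Finset.sum_congr rfl fun p _ => ?_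
  rw [hG.inv_symm, mul_comm]

omit hG in
theorem scalar_eq_sum_ricciUp (G : MetricComp n) (y : Coord n) :
    scalar G y = ∑ k, ricciUp G k k y := rfl

omit hG in
theorem sum_skew_mul_symm {P Γ : Fin n → Fin n → ℝ} (hP : ∀ a b, P a b = -P b a)
    (hΓ : ∀ a b, Γ a b = Γ b a) : ∑ a, ∑ b, P a b * Γ a b = 0 := by
  have h : ∑ a, ∑ b, P a b * Γ a b = -∑ a, ∑ b, P a b * Γ a b := by
    conv_lhs => rw [Finset.sum_comm]
    simp only [← Finset.sum_neg_distrib]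
    refine Finset.sum_congr rfl fun a _ => Finset.sum_congr rfl fun b _ => ?_
    rw [hP b a, hΓ b a]
    ring
  linarith

/-- The twice contracted Bianchi identity `∇_k R = 2 ∇_i R_k{}^i`. -/
theorem pd_scalar (hy : y ∈ D) (k : Fin n) :
    pd k (scalar G) y = 2 * ∑ i, (pd i (ricciUp G k i) y
      + ∑ p, (christoffel G i i p y * ricciUp G k p y
        - christoffel G p i k y * ricciUp G p i y)) := by
  have hP (j k a b) := differentiableAt_of_contDiffOn hG.isOpen (hG.smooth_curvUp j k a b) hy
  have hQ (k b z) : ricciUp G k b z = ∑ m, curvUp G m k z m b := hG.ricciUp_eq_sum_curvUp k b z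
  have hdQ (i k b) : pd i (ricciUp G k b) y = ∑ m, pd i (fun z => curvUp G m k z m b) y := by
    rw [← pd_sum _ _ fun m _ => hP m k m b]
    exact congrArg (fun F => pd i F y) (funext fun z => hQ k b z)
  have hds : pd k (scalar G) y = ∑ i, ∑ j, pd k (fun z => curvUp G i j z i j) y := by
    rw [Finset.sum_comm]
    simp only [← hdQ]
    rw [← pd_sum _ _ fun m _ => differentiableAt_of_contDiffOn hG.isOpen (hG.smooth_ricciUp m m) hy]
    rfl
  have hpsw (l j k a b) : pd l (fun z => curvUp G j k z a b) y
      = -pd l (fun z => curvUp G k j z a b) y := by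
    rw [← pd_neg]
    exact congrArg (fun F => pd l F y) (funext fun z => curvUp_swap j k a b)
  have hpsk (l j k a b) : pd l (fun z => curvUp G j k z a b) y
      = -pd l (fun z => curvUp G j k z b a) y := by
    rw [← pd_neg]
    exact pd_congr hG.isOpen hy (fun z hz => hG.curvUp_skew hz j k a b) l
  -- Bianchi contracted over both index pairs. The two mixed derivative groups each give minus the
  -- divergence of Ricci, the third gives the gradient of R; `e3` and `e5` vanish as skew against
  -- symmetric.
  have key : ∑ i, ∑ j, ((pd i (fun z => curvUp G j k z i j) y
        + ∑ p, christoffel G i i p y * curvUp G j k y p j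
        + ∑ p, curvUp G j k y i p * christoffel G j i p y)
      + (pd j (fun z => curvUp G k i z i j) y
        + ∑ p, christoffel G i j p y * curvUp G k i y p j
        + ∑ p, curvUp G k i y i p * christoffel G j j p y)
      + (pd k (fun z => curvUp G i j z i j) y
        + ∑ p, christoffel G i k p y * curvUp G i j y p j
        + ∑ p, curvUp G i j y i p * christoffel G j k p y)) = 0 := by
    refine Finset.sum_eq_zero fun i _ => Finset.sum_eq_zero fun j _ => ?_
    have := congrFun (congrFun (hG.bianchi_curvUp hy i j k) i) j
    simpa only [Matrix.add_apply, Matrix.mul_apply, Matrix.transpose_apply, connMat, pdMat,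
      Matrix.of_apply, Matrix.zero_apply] using this
  simp only [Finset.sum_add_distrib] at key
  have e1 : ∑ i, ∑ j, pd i (fun z => curvUp G j k z i j) y
      = -∑ i, pd i (ricciUp G k i) y := by
    simp only [hdQ, ← Finset.sum_neg_distrib]
    exact Finset.sum_congr rfl fun i _ => Finset.sum_congr rfl fun j _ => hpsk _ _ _ _ _
  have e2 : ∑ i, ∑ j, ∑ p, christoffel G i i p y * curvUp G j k y p j
      = -∑ i, ∑ p, christoffel G i i p y * ricciUp G k p y := by
    simp only [hQ, ← Finset.sum_neg_distrib, Finset.mul_sum]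
    refine Finset.sum_congr rfl fun i _ => ?_
    rw [Finset.sum_comm]
    refine Finset.sum_congr rfl fun p _ => ?_
    refine Finset.sum_congr rfl fun j _ => ?_
    rw [hG.curvUp_skew hy, mul_neg]
  have e3 : ∑ i, ∑ j, ∑ p, curvUp G j k y i p * christoffel G j i p y = 0 := by
    rw [Finset.sum_comm]
    exact Finset.sum_eq_zero fun j _ => sum_skew_mul_symm
      (fun a b => hG.curvUp_skew hy j k a b) (fun a b => hG.christoffel_symm j a b y)
  have e4 : ∑ i, ∑ j, pd j (fun z => curvUp G k i z i j) y
      = -∑ i, pd i (ricciUp G k i) y := by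
    simp only [hdQ, ← Finset.sum_neg_distrib]
    rw [Finset.sum_comm]
    exact Finset.sum_congr rfl fun i _ => Finset.sum_congr rfl fun j _ => hpsw _ _ _ _ _
  have e5 : ∑ i, ∑ j, ∑ p, christoffel G i j p y * curvUp G k i y p j = 0 := by
    refine Finset.sum_eq_zero fun i _ => ?_
    rw [← sum_skew_mul_symm (fun a b => hG.curvUp_skew hy k i b a)
      (fun a b => hG.christoffel_symm i a b y)]
    exact Finset.sum_congr rfl fun j _ => Finset.sum_congr rfl fun p _ => mul_comm _ _
  have e6 : ∑ i, ∑ j, ∑ p, curvUp G k i y i p * christoffel G j j p y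
      = -∑ i, ∑ p, christoffel G i i p y * ricciUp G k p y := by
    simp only [hQ, ← Finset.sum_neg_distrib, Finset.mul_sum]
    rw [Finset.sum_comm]
    refine Finset.sum_congr rfl fun j _ => ?_
    rw [Finset.sum_comm]
    refine Finset.sum_congr rfl fun p _ => ?_
    refine Finset.sum_congr rfl fun i _ => ?_
    rw [curvUp_swap]
    ring
  have e7 : ∑ i, ∑ j, ∑ p, christoffel G i k p y * curvUp G i j y p j
      = ∑ i, ∑ p, christoffel G p i k y * ricciUp G p i y := by
    conv_rhs => rw [Finset.sum_comm]
    simp only [hQ, Finset.mul_sum]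
    refine Finset.sum_congr rfl fun i _ => ?_
    rw [Finset.sum_comm]
    refine Finset.sum_congr rfl fun p _ => Finset.sum_congr rfl fun j _ => ?_
    rw [hG.curvUp_skew hy, curvUp_swap, neg_neg, hG.christoffel_symm]
  have e8 : ∑ i, ∑ j, ∑ p, curvUp G i j y i p * christoffel G j k p y
      = ∑ i, ∑ p, christoffel G p i k y * ricciUp G p i y := by
    conv_rhs => rw [Finset.sum_comm]
    simp only [hQ, Finset.mul_sum]
    rw [Finset.sum_comm]
    refine Finset.sum_congr rfl fun j _ => ?_
    rw [Finset.sum_comm]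
    refine Finset.sum_congr rfl fun p _ => Finset.sum_congr rfl fun i _ => ?_
    rw [hG.christoffel_symm, mul_comm]
  rw [e1, e2, e3, e4, e5, e6, e7, e8, ← hds] at key
  simp only [Finset.sum_add_distrib, Finset.sum_sub_distrib]
  linarith

/-- Schur's lemma: an Einstein metric in dimension at least three has constant curvature scalar. -/
theorem pd_scalar_eq_zero_of_einstein (hn : 3 ≤ n)
    (hE : ∀ z ∈ D, ∀ a b, ricci G a b z = scalar G z / n * G z a b) (hy : y ∈ D) (k : Fin n) :
    pd k (scalar G) y = 0 := by
  have hup (z) (hz : z ∈ D) (a b) : ricciUp G a b z = (n : ℝ)⁻¹ * scalar G z * delta a b := by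
    simp only [ricciUp, hE z hz]
    have := congrFun (congrFun (hG.inv_mul hz) b) a
    rw [Matrix.mul_apply, Matrix.one_apply] at this
    rw [delta, show (if a = b then (1 : ℝ) else 0) = if b = a then 1 else 0 from by
      simp only [eq_comm], ← this, Finset.mul_sum]
    refine Finset.sum_congr rfl fun p _ => ?_
    rw [hG.symm z a p]
    ring
  have hs := differentiableAt_of_contDiffOn hG.isOpen hG.smooth_scalar hy
  have hpd (i) : pd i (ricciUp G k i) y = (n : ℝ)⁻¹ * delta k i * pd i (scalar G) y := by
    rw [pd_congr hG.isOpen hy (fun z hz => (hup z hz k i).trans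
      (show _ = ((n : ℝ)⁻¹ * delta k i) * scalar G z by ring)),
      pd_mul i (differentiableAt_const _) hs, pd_const]
    ring
  have h := hG.pd_scalar hy k
  simp only [hpd, hup y hy, delta, mul_ite, mul_one, mul_zero, ite_mul, zero_mul,
    Finset.sum_add_distrib, Finset.sum_sub_distrib, Finset.sum_ite_eq, Finset.mem_univ,
    if_true, Finset.sum_ite_eq'] at h
  have hn' : (3 : ℝ) ≤ n := by exact_mod_cast hn
  -- With R_k{}^i = (R/n) δ_k{}^i the two connection terms cancel, leaving ∂R = (2/n) ∂R.
  have h2 : pd k (scalar G) y = 2 * ((n : ℝ)⁻¹ * pd k (scalar G) y) := by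
    linarith
  field_simp at h2
  have h3 : ((n : ℝ) - 2) * pd k (scalar G) y = 0 := by linarith
  rcases mul_eq_zero.1 h3 with h4 | h4
  · linarith
  · exact h4

end IsMetricOn

end Bianchi

/-! ### Derivatives of products a(t) F(x) -/

section SeparatedVariables

variable {m : ℕ} {a : ℝ → ℝ} {a' : ℝ} {F : Coord m → ℝ} {y : Coord (m + 1)}

/-- The projection `(t, x) ↦ x` as a continuous linear map. -/
def tailCLM (m : ℕ) : Coord (m + 1) →L[ℝ] Coord m :=
  ContinuousLinearMap.pi fun i => ContinuousLinearMap.proj i.succ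

theorem hasFDerivAt_separated (ha : HasDerivAt a a' (y 0)) (hF : DifferentiableAt ℝ F (Fin.tail y)) :
    HasFDerivAt (fun z : Coord (m + 1) => a (z 0) * F (Fin.tail z))
      (a (y 0) • (fderiv ℝ F (Fin.tail y)).comp (tailCLM m)
        + F (Fin.tail y) • a' • ContinuousLinearMap.proj (R := ℝ) (φ := fun _ => ℝ) 0) y := by
  have h1 : HasFDerivAt (fun z : Coord (m + 1) => a (z 0))
      (a' • ContinuousLinearMap.proj (R := ℝ) (φ := fun _ => ℝ) 0) y :=
    ha.comp_hasFDerivAt y (ContinuousLinearMap.proj (R := ℝ) (φ := fun _ => ℝ) 0).hasFDerivAt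
  have h2 : HasFDerivAt (fun z : Coord (m + 1) => F (Fin.tail z))
      ((fderiv ℝ F (Fin.tail y)).comp (tailCLM m)) y :=
    HasFDerivAt.comp (g := F) y hF.hasFDerivAt (tailCLM m).hasFDerivAt
  exact h1.mul h2

theorem pd_zero_separated (ha : HasDerivAt a a' (y 0)) (hF : DifferentiableAt ℝ F (Fin.tail y)) :
    pd 0 (fun z => a (z 0) * F (Fin.tail z)) y = a' * F (Fin.tail y) := by
  have h0 : tailCLM m (Pi.single 0 1) = 0 := by
    ext i
    simp [tailCLM]
  rw [pd, (hasFDerivAt_separated ha hF).fderiv]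
  simp [h0]
  ring

theorem pd_succ_separated (ha : HasDerivAt a a' (y 0)) (hF : DifferentiableAt ℝ F (Fin.tail y))
    (μ : Fin m) :
    pd μ.succ (fun z => a (z 0) * F (Fin.tail z)) y = a (y 0) * pd μ F (Fin.tail y) := by
  have h0 : tailCLM m (Pi.single μ.succ 1) = Pi.single μ 1 := by
    ext i
    simp [tailCLM, Pi.single_apply]
  rw [pd, (hasFDerivAt_separated ha hF).fderiv]
  simp [h0, pd]

end SeparatedVariables

/-! ### Warped product metrics and their Christoffel symbols -/

section Warped

variable {m : ℕ}

/-- The warped product metric `-dt² + q(t)² h_{μν}(x) dx^μ dx^ν`. -/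
def warped (q : ℝ → ℝ) (H : MetricComp m) : MetricComp (m + 1) := fun y =>
  Matrix.of (Fin.cons (Fin.cons (-1) (fun _ => 0))
    (fun μ => Fin.cons 0 (fun ν => q (y 0) ^ 2 * H (Fin.tail y) μ ν)))

variable (q : ℝ → ℝ) (H : MetricComp m) (y : Coord (m + 1)) (μ ν : Fin m)

theorem warped_zero_zero : warped q H y 0 0 = -1 := rfl

theorem warped_zero_succ : warped q H y 0 ν.succ = 0 := rfl

theorem warped_succ_zero : warped q H y μ.succ 0 = 0 := rfl

theorem warped_succ_succ :
    warped q H y μ.succ ν.succ = q (y 0) ^ 2 * H (Fin.tail y) μ ν := rfl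

/-- The hypotheses on a warped product metric over the open interval `I` and the open set `E`. -/
structure IsWarpedOn (q : ℝ → ℝ) (H : MetricComp m) (I : Set ℝ) (E : Set (Coord m)) : Prop where
  isOpen_I : IsOpen I
  smooth_q : ContDiffOn ℝ ∞ q I
  q_ne_zero : ∀ t ∈ I, q t ≠ 0
  fibre : IsMetricOn H E

namespace IsWarpedOn

variable {q H} {I : Set ℝ} {E : Set (Coord m)} (hw : IsWarpedOn q H I E)

/-- The coordinate domain of a warped product. -/
def _root_.GRW.warpedDomain (I : Set ℝ) (E : Set (Coord m)) : Set (Coord (m + 1)) :=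
  {y | y 0 ∈ I ∧ Fin.tail y ∈ E}

include hw

theorem hasDerivAt_q {t : ℝ} (ht : t ∈ I) : HasDerivAt q (deriv q t) t :=
  ((hw.smooth_q.contDiffAt (hw.isOpen_I.mem_nhds ht)).differentiableAt (by simp)).hasDerivAt

theorem hasDerivAt_deriv_q {t : ℝ} (ht : t ∈ I) :
    HasDerivAt (deriv q) (deriv (deriv q) t) t :=
  (((hw.smooth_q.deriv_of_isOpen hw.isOpen_I (m := ∞) (by simp)).contDiffAt
    (hw.isOpen_I.mem_nhds ht)).differentiableAt (by simp)).hasDerivAt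

variable {y : Coord (m + 1)}

theorem isOpen_domain : IsOpen (warpedDomain I E) :=
  (hw.isOpen_I.preimage (continuous_apply 0)).inter
    (hw.fibre.isOpen.preimage (tailCLM m).continuous)

/-- An explicit block right inverse yields both the inverse metric and the nonvanishing of the
determinant. -/
theorem warped_mul_inv (hy : y ∈ warpedDomain I E) : warped q H y *
    Matrix.of (Fin.cons (Fin.cons (-1) (fun _ => 0))
      (fun μ => Fin.cons 0 (fun ν => (q (y 0) ^ 2)⁻¹ * (H (Fin.tail y))⁻¹ μ ν))) = 1 := by
  have hq := hw.q_ne_zero _ hy.1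
  ext i j
  rw [Matrix.mul_apply, Fin.sum_univ_succ]
  refine Fin.cases ?_ (fun μ => ?_) i <;> refine Fin.cases ?_ (fun ν => ?_) j
  · simp [warped]
  · simp [warped, (Fin.succ_ne_zero ν).symm]
  · simp [warped]
  · have h := congrFun (congrFun (hw.fibre.mul_inv hy.2) μ) ν
    rw [Matrix.mul_apply] at h
    simp only [warped, Matrix.of_apply, Fin.cons_succ, Fin.cons_zero, zero_mul, zero_add,
      Matrix.one_apply, Fin.succ_inj] at h ⊢
    rw [← h]
    refine Finset.sum_congr rfl fun p _ => ?_
    field_simp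

theorem inv_eq (hy : y ∈ warpedDomain I E) : (warped q H y)⁻¹ =
    Matrix.of (Fin.cons (Fin.cons (-1) (fun _ => 0))
      (fun μ => Fin.cons 0 (fun ν => (q (y 0) ^ 2)⁻¹ * (H (Fin.tail y))⁻¹ μ ν))) :=
  Matrix.inv_eq_right_inv (hw.warped_mul_inv hy)

theorem inv_zero_zero (hy : y ∈ warpedDomain I E) : (warped q H y)⁻¹ 0 0 = -1 := by
  rw [hw.inv_eq hy]; rfl

theorem inv_zero_succ (hy : y ∈ warpedDomain I E) : (warped q H y)⁻¹ 0 ν.succ = 0 := by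
  rw [hw.inv_eq hy]; rfl

theorem inv_succ_zero (hy : y ∈ warpedDomain I E) : (warped q H y)⁻¹ μ.succ 0 = 0 := by
  rw [hw.inv_eq hy]; rfl

theorem inv_succ_succ (hy : y ∈ warpedDomain I E) : (warped q H y)⁻¹ μ.succ ν.succ
    = (q (y 0) ^ 2)⁻¹ * (H (Fin.tail y))⁻¹ μ ν := by
  rw [hw.inv_eq hy]; rfl

theorem isMetricOn : IsMetricOn (warped q H) (warpedDomain I E) where
  isOpen := hw.isOpen_domain
  smooth := by
    have hqs : ContDiffOn ℝ ∞ (fun z : Coord (m + 1) => q (z 0)) (warpedDomain I E) :=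
      hw.smooth_q.comp (contDiff_apply ℝ ℝ (0 : Fin (m + 1))).contDiffOn fun z hz => hz.1
    intro i j
    refine Fin.cases ?_ (fun μ => ?_) i <;> refine Fin.cases ?_ (fun ν => ?_) j
    · exact contDiffOn_const
    · exact contDiffOn_const
    · exact contDiffOn_const
    · exact (hqs.pow 2).mul ((hw.fibre.smooth μ ν).comp (tailCLM m).contDiff.contDiffOn
        fun z hz => hz.2)
  symm := by
    intro z i j
    refine Fin.cases ?_ (fun μ => ?_) i <;> refine Fin.cases ?_ (fun ν => ?_) j
    · rfl
    · rfl
    · rfl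
    · rw [warped_succ_succ, warped_succ_succ, hw.fibre.symm]
  det_ne_zero z hz := (Matrix.isUnit_det_of_right_inverse (hw.warped_mul_inv hz)).ne_zero

theorem pd_zero_warped (hy : y ∈ warpedDomain I E) :
    pd 0 (fun z => warped q H z μ.succ ν.succ) y
      = 2 * q (y 0) * deriv q (y 0) * H (Fin.tail y) μ ν := by
  have h := (hw.hasDerivAt_q hy.1).pow 2
  simpa [warped_succ_succ, mul_assoc] using pd_zero_separated h
    (differentiableAt_of_contDiffOn hw.fibre.isOpen (hw.fibre.smooth μ ν) hy.2)

theorem pd_succ_warped (hy : y ∈ warpedDomain I E) (ρ : Fin m) :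
    pd ρ.succ (fun z => warped q H z μ.succ ν.succ) y
      = q (y 0) ^ 2 * pd ρ (fun z => H z μ ν) (Fin.tail y) := by
  have h := (hw.hasDerivAt_q hy.1).pow 2
  simpa [warped_succ_succ] using pd_succ_separated h
    (differentiableAt_of_contDiffOn hw.fibre.isOpen (hw.fibre.smooth μ ν) hy.2) ρ

theorem christoffel_zero_zero_zero (hy : y ∈ warpedDomain I E) :
    christoffel (warped q H) 0 0 0 y = 0 := by
  simp [christoffel, Fin.sum_univ_succ, warped_zero_zero, hw.inv_zero_succ _ hy, pd_const]

theorem christoffel_zero_zero_succ (hy : y ∈ warpedDomain I E) :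
    christoffel (warped q H) 0 0 μ.succ y = 0 := by
  simp [christoffel, Fin.sum_univ_succ, warped_zero_zero, warped_succ_zero, warped_zero_succ,
    hw.inv_zero_succ _ hy, pd_const]

theorem christoffel_zero_succ_zero (hy : y ∈ warpedDomain I E) :
    christoffel (warped q H) 0 μ.succ 0 y = 0 := by
  rw [hw.isMetricOn.christoffel_symm, hw.christoffel_zero_zero_succ μ hy]

theorem christoffel_zero_succ_succ (hy : y ∈ warpedDomain I E) :
    christoffel (warped q H) 0 μ.succ ν.succ y
      = q (y 0) * deriv q (y 0) * H (Fin.tail y) μ ν := by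
  simp [christoffel, Fin.sum_univ_succ, warped_succ_zero, hw.inv_zero_succ _ hy,
    hw.inv_zero_zero hy, pd_const, hw.pd_zero_warped _ _ hy]
  ring

theorem christoffel_succ_zero_zero (hy : y ∈ warpedDomain I E) :
    christoffel (warped q H) μ.succ 0 0 y = 0 := by
  simp [christoffel, Fin.sum_univ_succ, warped_zero_zero, warped_zero_succ,
    hw.inv_succ_zero _ hy, pd_const]

theorem christoffel_succ_zero_succ (hy : y ∈ warpedDomain I E) :
    christoffel (warped q H) μ.succ 0 ν.succ y = deriv q (y 0) / q (y 0) * delta μ ν := by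
  have hq := hw.q_ne_zero _ hy.1
  have h := congrFun (congrFun (hw.fibre.inv_mul hy.2) μ) ν
  rw [Matrix.mul_apply, Matrix.one_apply] at h
  simp only [christoffel, Fin.sum_univ_succ, warped_zero_succ, warped_succ_zero,
    hw.inv_succ_zero _ hy, pd_const, hw.pd_zero_warped _ _ hy, hw.inv_succ_succ _ _ hy, delta,
    ← h, Finset.mul_sum, zero_mul, zero_add, add_zero, sub_zero]
  refine Finset.sum_congr rfl fun p _ => ?_
  rw [hw.fibre.symm _ ν p]
  field_simp

theorem christoffel_succ_succ_zero (hy : y ∈ warpedDomain I E) :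
    christoffel (warped q H) μ.succ ν.succ 0 y = deriv q (y 0) / q (y 0) * delta μ ν := by
  rw [hw.isMetricOn.christoffel_symm, hw.christoffel_succ_zero_succ μ ν hy]

theorem christoffel_succ_succ_succ (hy : y ∈ warpedDomain I E) (ρ : Fin m) :
    christoffel (warped q H) ρ.succ μ.succ ν.succ y = christoffel H ρ μ ν (Fin.tail y) := by
  have hq := hw.q_ne_zero _ hy.1
  simp only [christoffel, Fin.sum_univ_succ, hw.inv_succ_zero _ hy, hw.pd_succ_warped _ _ hy,
    hw.inv_succ_succ _ _ hy, zero_mul, zero_add]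
  congr 1
  refine Finset.sum_congr rfl fun p _ => ?_
  field_simp

end IsWarpedOn

end Warped

theorem pd_eq_zero_of_eqOn {n : ℕ} {D : Set (Coord n)} {F : Coord n → ℝ} {y : Coord n}
    (hD : IsOpen D) (hy : y ∈ D) (h : ∀ z ∈ D, F z = 0) (i : Fin n) : pd i F y = 0 :=
  (pd_congr hD hy h i).trans (pd_const i 0 y)

/-! ### Curvature of a warped product -/

section WarpedCurvature

variable {m : ℕ}

theorem delta_comm (μ ν : Fin m) : delta μ ν = delta ν μ := by
  simp only [delta, eq_comm]

theorem sum_mul_delta (v : Fin m → ℝ) (ν : Fin m) : ∑ p, v p * delta p ν = v ν := by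
  simp [delta]

theorem sum_delta_mul (v : Fin m → ℝ) (ν : Fin m) : ∑ p, delta ν p * v p = v ν := by
  simp [delta]

theorem riemann_swap {n : ℕ} (G : MetricComp n) (j k l p : Fin n) (y : Coord n) :
    riemann G j k l p y = -riemann G k j l p y := by
  rw [riemann_eq_curvMat, riemann_eq_curvMat, curvMat_swap, Matrix.neg_apply]

theorem riemann_self {n : ℕ} (G : MetricComp n) (j l p : Fin n) (y : Coord n) :
    riemann G j j l p y = 0 := by
  linarith [riemann_swap G j j l p y]

namespace IsWarpedOn

variable {q : ℝ → ℝ} {H : MetricComp m} {I : Set ℝ} {E : Set (Coord m)}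
  (hw : IsWarpedOn q H I E) {y : Coord (m + 1)} (μ ν : Fin m)

include hw

theorem pd_christoffel_zero_zero_zero (hy : y ∈ warpedDomain I E) (i : Fin (m + 1)) :
    pd i (christoffel (warped q H) 0 0 0) y = 0 :=
  pd_eq_zero_of_eqOn hw.isOpen_domain hy (fun _ hz => hw.christoffel_zero_zero_zero hz) i

theorem pd_christoffel_zero_zero_succ (hy : y ∈ warpedDomain I E) (i : Fin (m + 1)) :
    pd i (christoffel (warped q H) 0 0 μ.succ) y = 0 :=
  pd_eq_zero_of_eqOn hw.isOpen_domain hy (fun _ hz => hw.christoffel_zero_zero_succ μ hz) i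

theorem pd_christoffel_zero_succ_zero (hy : y ∈ warpedDomain I E) (i : Fin (m + 1)) :
    pd i (christoffel (warped q H) 0 μ.succ 0) y = 0 :=
  pd_eq_zero_of_eqOn hw.isOpen_domain hy (fun _ hz => hw.christoffel_zero_succ_zero μ hz) i

theorem pd_christoffel_succ_zero_zero (hy : y ∈ warpedDomain I E) (i : Fin (m + 1)) :
    pd i (christoffel (warped q H) μ.succ 0 0) y = 0 :=
  pd_eq_zero_of_eqOn hw.isOpen_domain hy (fun _ hz => hw.christoffel_succ_zero_zero μ hz) i

theorem hasDerivAt_mul_deriv {t : ℝ} (ht : t ∈ I) : HasDerivAt (fun t => q t * deriv q t)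
    (deriv q t ^ 2 + q t * deriv (deriv q) t) t := by
  refine ((hw.hasDerivAt_q ht).fun_mul (hw.hasDerivAt_deriv_q ht)).congr_deriv ?_
  ring

theorem hasDerivAt_hubble {t : ℝ} (ht : t ∈ I) : HasDerivAt (fun t => deriv q t / q t)
    (deriv (deriv q) t / q t - (deriv q t / q t) ^ 2) t := by
  have hq := hw.q_ne_zero _ ht
  refine ((hw.hasDerivAt_deriv_q ht).fun_div (hw.hasDerivAt_q ht) hq).congr_deriv ?_
  field_simp

theorem pd_zero_christoffel_zero_succ_succ (hy : y ∈ warpedDomain I E) :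
    pd 0 (christoffel (warped q H) 0 μ.succ ν.succ) y
      = (deriv q (y 0) ^ 2 + q (y 0) * deriv (deriv q) (y 0)) * H (Fin.tail y) μ ν := by
  rw [pd_congr hw.isOpen_domain hy fun z hz => hw.christoffel_zero_succ_succ μ ν hz]
  exact pd_zero_separated (hw.hasDerivAt_mul_deriv hy.1)
    (differentiableAt_of_contDiffOn hw.fibre.isOpen (hw.fibre.smooth μ ν) hy.2)

theorem pd_succ_christoffel_succ_zero_succ (hy : y ∈ warpedDomain I E) (ρ : Fin m) :
    pd ρ.succ (christoffel (warped q H) μ.succ 0 ν.succ) y = 0 := by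
  rw [pd_congr hw.isOpen_domain hy fun z hz => hw.christoffel_succ_zero_succ μ ν hz]
  refine (pd_succ_separated (F := fun _ => delta μ ν) (hw.hasDerivAt_hubble hy.1)
    (differentiableAt_const _) ρ).trans ?_
  rw [pd_const, mul_zero]

theorem pd_zero_christoffel_succ_succ_zero (hy : y ∈ warpedDomain I E) :
    pd 0 (christoffel (warped q H) μ.succ ν.succ 0) y
      = (deriv (deriv q) (y 0) / q (y 0) - (deriv q (y 0) / q (y 0)) ^ 2) * delta μ ν := by
  rw [pd_congr hw.isOpen_domain hy fun z hz => hw.christoffel_succ_succ_zero μ ν hz]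
  exact pd_zero_separated (F := fun _ => delta μ ν) (hw.hasDerivAt_hubble hy.1)
    (differentiableAt_const _)

theorem pd_zero_christoffel_succ_succ_succ (hy : y ∈ warpedDomain I E) (ρ : Fin m) :
    pd 0 (christoffel (warped q H) ρ.succ μ.succ ν.succ) y = 0 := by
  rw [pd_congr hw.isOpen_domain hy fun z hz => hw.christoffel_succ_succ_succ μ ν hz ρ]
  simpa using pd_zero_separated (hasDerivAt_const (y 0) (1 : ℝ))
    (differentiableAt_of_contDiffOn hw.fibre.isOpen (hw.fibre.smooth_christoffel ρ μ ν) hy.2)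

theorem pd_succ_christoffel_succ_succ_succ (hy : y ∈ warpedDomain I E) (ρ σ : Fin m) :
    pd σ.succ (christoffel (warped q H) ρ.succ μ.succ ν.succ) y
      = pd σ (christoffel H ρ μ ν) (Fin.tail y) := by
  rw [pd_congr hw.isOpen_domain hy fun z hz => hw.christoffel_succ_succ_succ μ ν hz ρ]
  simpa using pd_succ_separated (hasDerivAt_const (y 0) (1 : ℝ))
    (differentiableAt_of_contDiffOn hw.fibre.isOpen (hw.fibre.smooth_christoffel ρ μ ν) hy.2) σ

theorem riemann_zero_succ_zero_zero (hy : y ∈ warpedDomain I E) :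
    riemann (warped q H) 0 μ.succ 0 0 y = 0 := by
  simp [riemann, Fin.sum_univ_succ, hw.pd_christoffel_zero_zero_zero hy,
    hw.pd_christoffel_zero_succ_zero _ hy, hw.christoffel_zero_zero_zero hy,
    hw.christoffel_zero_succ_zero _ hy, hw.christoffel_zero_zero_succ _ hy,
    hw.christoffel_succ_zero_zero _ hy]

theorem riemann_zero_succ_succ_zero (hy : y ∈ warpedDomain I E) :
    riemann (warped q H) 0 μ.succ ν.succ 0 y
      = -(q (y 0) * deriv (deriv q) (y 0) * H (Fin.tail y) μ ν) := by
  have hq := hw.q_ne_zero _ hy.1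
  have h := sum_mul_delta (fun p => q (y 0) * deriv q (y 0) * H (Fin.tail y) μ p
    * (deriv q (y 0) / q (y 0))) ν
  simp only [mul_assoc] at h
  simp [riemann, Fin.sum_univ_succ, hw.pd_zero_christoffel_zero_succ_succ _ _ hy,
    hw.pd_christoffel_zero_zero_succ _ hy, hw.christoffel_zero_zero_zero hy,
    hw.christoffel_zero_succ_zero _ hy, hw.christoffel_zero_zero_succ _ hy,
    hw.christoffel_zero_succ_succ _ _ hy, hw.christoffel_succ_zero_succ _ _ hy, mul_assoc, h]
  field_simp
  ring

theorem riemann_zero_succ_zero_succ (hy : y ∈ warpedDomain I E) :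
    riemann (warped q H) 0 μ.succ 0 ν.succ y
      = -(deriv (deriv q) (y 0) / q (y 0) * delta μ ν) := by
  have h := sum_mul_delta (fun p => deriv q (y 0) / q (y 0) * delta ν p
    * (deriv q (y 0) / q (y 0))) μ
  simp only [mul_assoc] at h
  simp [riemann, Fin.sum_univ_succ, hw.pd_christoffel_succ_zero_zero _ hy,
    hw.pd_zero_christoffel_succ_succ_zero _ _ hy, hw.christoffel_zero_zero_zero hy,
    hw.christoffel_zero_succ_zero _ hy, hw.christoffel_succ_zero_zero _ hy,
    hw.christoffel_succ_zero_succ _ _ hy, hw.christoffel_succ_succ_zero _ _ hy, mul_assoc, h,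
    delta_comm μ ν]
  ring

/-- Codazzi: the slices are umbilic with a rate q'/q that is constant on each slice. -/
theorem riemann_zero_succ_succ_succ (hy : y ∈ warpedDomain I E) (ρ : Fin m) :
    riemann (warped q H) 0 μ.succ ν.succ ρ.succ y = 0 := by
  have h1 := sum_mul_delta (fun p => christoffel H ρ μ p (Fin.tail y)
    * (deriv q (y 0) / q (y 0))) ν
  have h2 := sum_delta_mul (fun p => christoffel H p μ ν (Fin.tail y)) ρ
  simp only [mul_assoc] at h1
  simp [riemann, Fin.sum_univ_succ, hw.pd_succ_christoffel_succ_zero_succ _ _ hy,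
    hw.pd_zero_christoffel_succ_succ_succ _ _ hy, hw.christoffel_zero_zero_succ _ hy,
    hw.christoffel_succ_zero_zero _ hy, hw.christoffel_succ_succ_succ _ _ hy,
    hw.christoffel_succ_zero_succ _ _ hy, mul_assoc, h1, h2, ← Finset.mul_sum]
  ring

/-- Gauss equation: the correction to the fibre curvature comes from the products of Γ^0_{μν} = q q'
h_{μν} and Γ^μ_{ν0} = (q'/q) δ. -/
theorem riemann_succ_succ_succ_succ (hy : y ∈ warpedDomain I E) (ρ σ : Fin m) :
    riemann (warped q H) μ.succ ν.succ ρ.succ σ.succ y = riemann H μ ν ρ σ (Fin.tail y)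
      + deriv q (y 0) ^ 2 * (delta σ ν * H (Fin.tail y) μ ρ - delta σ μ * H (Fin.tail y) ν ρ) := by
  have hq := hw.q_ne_zero _ hy.1
  simp only [riemann, Fin.sum_univ_succ, hw.pd_succ_christoffel_succ_succ_succ _ _ hy,
    hw.christoffel_succ_succ_succ _ _ hy, hw.christoffel_zero_succ_succ _ _ hy,
    hw.christoffel_succ_succ_zero _ _ hy]
  field_simp
  ring

theorem ricci_zero_zero (hy : y ∈ warpedDomain I E) :
    ricci (warped q H) 0 0 y = -(m * (deriv (deriv q) (y 0) / q (y 0))) := by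
  simp only [ricci, Fin.sum_univ_succ, riemann_self, riemann_swap _ (Fin.succ _) 0,
    hw.riemann_zero_succ_zero_succ _ _ hy]
  simp [delta]

theorem ricci_zero_succ (hy : y ∈ warpedDomain I E) :
    ricci (warped q H) 0 μ.succ y = 0 := by
  simp [ricci, Fin.sum_univ_succ, riemann_self, riemann_swap _ (Fin.succ _) 0,
    hw.riemann_zero_succ_succ_succ _ _ hy]

/-- Serves the Ricci component with indices in the order (μ, 0), which is computed directly instead
of through symmetry of the Ricci tensor. -/
theorem riemann_succ_succ_zero_succ (hy : y ∈ warpedDomain I E) (ρ : Fin m) :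
    riemann (warped q H) μ.succ ν.succ 0 ρ.succ y = 0 := by
  have h (μ ν) := sum_mul_delta (fun p => christoffel H ρ ν p (Fin.tail y)
    * (deriv q (y 0) / q (y 0))) μ
  simp only [mul_assoc] at h
  have hz (σ : Fin m) : pd σ.succ (christoffel (warped q H) ρ.succ μ.succ 0) y = 0 ∧
      pd σ.succ (christoffel (warped q H) ρ.succ ν.succ 0) y = 0 := by
    constructor <;>
    · rw [← hw.pd_succ_christoffel_succ_zero_succ ρ _ hy σ]
      exact congrArg (fun F => pd σ.succ F y)
        (funext fun z => hw.isMetricOn.christoffel_symm _ _ _ z)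
  simp [riemann, Fin.sum_univ_succ, (hz _).1, (hz _).2, hw.christoffel_zero_succ_zero _ hy,
    hw.christoffel_succ_succ_zero _ _ hy, hw.christoffel_succ_succ_succ _ _ hy,
    Finset.sum_sub_distrib, h, hw.fibre.christoffel_symm ρ μ ν]

theorem ricci_succ_zero (hy : y ∈ warpedDomain I E) :
    ricci (warped q H) μ.succ 0 y = 0 := by
  simp [ricci, Fin.sum_univ_succ, hw.riemann_zero_succ_zero_zero _ hy,
    hw.riemann_succ_succ_zero_succ _ _ hy]

theorem ricci_succ_succ (hy : y ∈ warpedDomain I E) :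
    ricci (warped q H) μ.succ ν.succ y = ricci H μ ν (Fin.tail y)
      + ((m - 1) * deriv q (y 0) ^ 2 + q (y 0) * deriv (deriv q) (y 0))
        * H (Fin.tail y) μ ν := by
  have h := sum_delta_mul (fun p => H (Fin.tail y) p ν) μ
  simp only [ricci, Fin.sum_univ_succ, hw.riemann_zero_succ_succ_zero _ _ hy,
    hw.riemann_succ_succ_succ_succ _ _ hy, Finset.sum_add_distrib, ← Finset.mul_sum,
    Finset.sum_sub_distrib]
  simp only [delta_comm _ μ, h]
  simp [delta]
  ring

omit hw in
theorem _root_.GRW.IsMetricOn.sum_inv_mul_self {n : ℕ} {G : MetricComp n} {D : Set (Coord n)} (hG : IsMetricOn G D)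
    {z : Coord n} (hz : z ∈ D) : ∑ k, ∑ l, (G z)⁻¹ k l * G z k l = n := by
  have h := congrArg Matrix.trace (hG.inv_mul hz)
  simp only [Matrix.trace, Matrix.diag, Matrix.mul_apply, Matrix.one_apply_eq, Finset.sum_const,
    Finset.card_univ, Fintype.card_fin, nsmul_eq_mul, mul_one] at h
  rw [← h]
  exact Finset.sum_congr rfl fun k _ => Finset.sum_congr rfl fun l _ => by rw [hG.symm z k l]

theorem scalar_eq (hy : y ∈ warpedDomain I E) :
    scalar (warped q H) y = scalar H (Fin.tail y) / q (y 0) ^ 2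
      + m * (m - 1) * (deriv q (y 0) / q (y 0)) ^ 2
      + 2 * m * (deriv (deriv q) (y 0) / q (y 0)) := by
  have hq := hw.q_ne_zero _ hy.1
  have h := hw.fibre.sum_inv_mul_self hy.2
  have e : ∑ μ : Fin m, ∑ ν : Fin m, (warped q H y)⁻¹ μ.succ ν.succ * ricci (warped q H) μ.succ ν.succ y
      = (q (y 0) ^ 2)⁻¹ * (scalar H (Fin.tail y)
        + ((m - 1) * deriv q (y 0) ^ 2 + q (y 0) * deriv (deriv q) (y 0))
          * ∑ k, ∑ l, (H (Fin.tail y))⁻¹ k l * H (Fin.tail y) k l) := by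
    simp only [scalar, hw.inv_succ_succ _ _ hy, hw.ricci_succ_succ _ _ hy, Finset.mul_sum, mul_add,
      Finset.sum_add_distrib]
    congr 1
    · simp only [mul_assoc]
    · refine Finset.sum_congr rfl fun k _ => Finset.sum_congr rfl fun l _ => ?_
      ring
  simp only [scalar, Fin.sum_univ_succ (n := m), hw.inv_zero_succ _ hy, hw.inv_succ_zero _ hy,
    zero_mul, zero_add, Finset.sum_const_zero, add_zero]
  rw [e, h, hw.inv_zero_zero hy, hw.ricci_zero_zero hy]
  rw [scalar]
  field_simp
  ring

end IsWarpedOn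

end WarpedCurvature

/-! ### The Weyl tensor and its trace -/

section WeylTensor

theorem weyl_self {n : ℕ} (G : MetricComp n) (j l p : Fin n) (y : Coord n) :
    weyl G j j l p y = 0 := by
  simp [weyl, riemann_self]

/-- The Weyl tensor is totally trace-free. -/
theorem IsMetricOn.sum_weyl {n : ℕ} {G : MetricComp n} {D : Set (Coord n)} (hG : IsMetricOn G D)
    (hn : 3 ≤ n) {y : Coord n} (hy : y ∈ D) (k l : Fin n) : ∑ j, weyl G j k l j y = 0 := by
  have hn' : (3 : ℝ) ≤ n := by exact_mod_cast hn
  have h1 : (n : ℝ) - 1 ≠ 0 := by linarith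
  have h2 : (n : ℝ) - 2 ≠ 0 := by linarith
  have hr : ∑ j, riemann G j k l j y = -ricci G k l y := by simp [ricci]
  have hu : ∑ j, ricciUp G k j y * G y j l = ricci G k l y := by
    simp only [ricciUp, Finset.sum_mul]
    rw [Finset.sum_comm, ← sum_mul_delta (fun p => ricci G k p y) l]
    refine Finset.sum_congr rfl fun p _ => ?_
    have h := congrFun (congrFun (hG.inv_mul hy) p) l
    rw [Matrix.mul_apply, Matrix.one_apply] at h
    rw [delta, ← h, Finset.mul_sum]
    refine Finset.sum_congr rfl fun j _ => ?_
    rw [hG.inv_symm y j p]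
    ring
  have hd : ∑ j : Fin n, delta j j = (n : ℝ) := by simp [delta]
  have hd1 := sum_delta_mul (fun j => ricci G j l y) k
  have hd2 := sum_delta_mul (fun j => G y j l) k
  simp only [weyl, Finset.sum_add_distrib, Finset.sum_sub_distrib, ← Finset.mul_sum,
    ← Finset.sum_mul, hr, hu, hd, hd1, hd2, ← scalar_eq_sum_ricciUp]
  field_simp
  ring

end WeylTensor

/-! ### Divergence of the Weyl tensor and the Einstein condition on the fibre -/

section WarpedWeyl

variable {m : ℕ}

/-- The trace-free Ricci tensor. -/
def traceFreeRicci (H : MetricComp m) (μ ν : Fin m) (x : Coord m) : ℝ :=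
  ricci H μ ν x - scalar H x / m * H x μ ν

namespace IsWarpedOn

variable {q : ℝ → ℝ} {H : MetricComp m} {I : Set ℝ} {E : Set (Coord m)}
  (hw : IsWarpedOn q H I E) {y : Coord (m + 1)} (μ ν : Fin m)

include hw

theorem ricciUp_zero_zero (hy : y ∈ warpedDomain I E) :
    ricciUp (warped q H) 0 0 y = m * (deriv (deriv q) (y 0) / q (y 0)) := by
  simp [ricciUp, Fin.sum_univ_succ, hw.inv_zero_zero hy, hw.inv_zero_succ _ hy,
    hw.ricci_zero_zero hy]

theorem ricciUp_zero_succ (hy : y ∈ warpedDomain I E) :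
    ricciUp (warped q H) 0 μ.succ y = 0 := by
  simp [ricciUp, Fin.sum_univ_succ, hw.inv_succ_zero _ hy, hw.ricci_zero_succ _ hy]

theorem ricciUp_succ_zero (hy : y ∈ warpedDomain I E) :
    ricciUp (warped q H) μ.succ 0 y = 0 := by
  simp [ricciUp, Fin.sum_univ_succ, hw.inv_zero_succ _ hy, hw.ricci_succ_zero _ hy]

theorem sum_metric_mul_ricciUp (hy : y ∈ warpedDomain I E) :
    ∑ σ : Fin m, H (Fin.tail y) σ ν * ricciUp (warped q H) μ.succ σ.succ y
      = (q (y 0) ^ 2)⁻¹ * ricci (warped q H) μ.succ ν.succ y := by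
  simp only [ricciUp, Fin.sum_univ_succ, hw.inv_succ_zero _ hy, hw.inv_succ_succ _ _ hy,
    zero_mul, zero_add, Finset.mul_sum]
  rw [Finset.sum_comm, ← sum_mul_delta
    (fun p => (q (y 0) ^ 2)⁻¹ * ricci (warped q H) μ.succ p.succ y) ν]
  refine Finset.sum_congr rfl fun p _ => ?_
  have h := congrFun (congrFun (hw.fibre.inv_mul hy.2) p) ν
  rw [Matrix.mul_apply, Matrix.one_apply] at h
  rw [delta, ← h, Finset.mul_sum]
  refine Finset.sum_congr rfl fun j _ => ?_
  rw [hw.fibre.inv_symm _ j p]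
  ring

/-- No q survives: with dτ = dt/q the metric is q² (-dτ² + h), and C_{jkl}{}^m is conformally
invariant. The computation shows this as cancellation of all terms in q' and q''. -/
theorem weyl_zero_succ_succ_zero (hm : 2 ≤ m) (hy : y ∈ warpedDomain I E) :
    weyl (warped q H) 0 μ.succ ν.succ 0 y
      = 1 / ((m : ℝ) - 1) * traceFreeRicci H μ ν (Fin.tail y) := by
  have hq := hw.q_ne_zero _ hy.1
  have hm' : (2 : ℝ) ≤ m := by exact_mod_cast hm
  have h0 : (m : ℝ) ≠ 0 := by linarith
  have h1 : (m : ℝ) - 1 ≠ 0 := by linarith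
  have h2 : ((m + 1 : ℕ) : ℝ) - 2 = m - 1 := by push_cast; ring
  have h3 : ((m + 1 : ℕ) : ℝ) - 1 = m := by push_cast; ring
  simp only [weyl, h2, h3, hw.riemann_zero_succ_succ_zero _ _ hy, hw.ricciUp_zero_zero hy,
    hw.ricci_succ_succ _ _ hy, hw.ricciUp_succ_zero _ hy, warped_succ_succ, warped_zero_succ,
    hw.scalar_eq hy, traceFreeRicci, delta, if_true, Fin.succ_ne_zero, if_false]
  field_simp
  ring

theorem weyl_zero_succ_succ_succ (hy : y ∈ warpedDomain I E) (ρ : Fin m) :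
    weyl (warped q H) 0 μ.succ ν.succ ρ.succ y = 0 := by
  simp [weyl, delta, hw.riemann_zero_succ_succ_succ _ _ hy, hw.ricci_zero_succ _ hy,
    hw.ricciUp_zero_succ _ hy, warped_zero_succ, (Fin.succ_ne_zero _).symm]

/-- Amounts to the skewness of the fully lowered Weyl tensor in its last two indices, found by
direct computation. -/
theorem sum_metric_mul_weyl (hm : 2 ≤ m) (hy : y ∈ warpedDomain I E) :
    ∑ σ : Fin m, H (Fin.tail y) σ ν * weyl (warped q H) 0 μ.succ 0 σ.succ y
      = (q (y 0) ^ 2)⁻¹ * (1 / ((m : ℝ) - 1) * traceFreeRicci H μ ν (Fin.tail y)) := by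
  have hq := hw.q_ne_zero _ hy.1
  have hm' : (2 : ℝ) ≤ m := by exact_mod_cast hm
  have h0 : (m : ℝ) ≠ 0 := by linarith
  have h1 : (m : ℝ) - 1 ≠ 0 := by linarith
  have h2 : ((m + 1 : ℕ) : ℝ) - 2 = m - 1 := by push_cast; ring
  have h3 : ((m + 1 : ℕ) : ℝ) - 1 = m := by push_cast; ring
  have hd (σ : Fin m) : delta μ.succ σ.succ = delta μ σ := by simp [delta]
  have hd' (σ : Fin m) : delta 0 σ.succ = 0 := by simp [delta, (Fin.succ_ne_zero _).symm]
  have e (σ : Fin m) : H (Fin.tail y) σ ν * weyl (warped q H) 0 μ.succ 0 σ.succ y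
      = delta μ σ * H (Fin.tail y) σ ν * (-(deriv (deriv q) (y 0) / q (y 0))
          + 1 / ((m : ℝ) - 1) * (m * (deriv (deriv q) (y 0) / q (y 0)))
          - scalar (warped q H) y / (m * (m - 1)))
        + 1 / ((m : ℝ) - 1) * (H (Fin.tail y) σ ν * ricciUp (warped q H) μ.succ σ.succ y) := by
    simp only [weyl, h2, h3, hw.riemann_zero_succ_zero_succ _ _ hy, hw.ricciUp_zero_succ _ hy,
      hw.ricci_succ_zero _ hy, hw.ricci_zero_zero hy, warped_succ_zero, warped_zero_zero, hd, hd']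
    ring
  simp only [e, Finset.sum_add_distrib, ← Finset.sum_mul, ← Finset.mul_sum,
    hw.sum_metric_mul_ricciUp _ _ hy, sum_delta_mul (fun σ => H (Fin.tail y) σ ν) μ,
    hw.ricci_succ_succ _ _ hy, hw.scalar_eq hy, traceFreeRicci]
  field_simp
  ring

/-- With W = C_{0μν}{}^0, the derivative terms vanish because W is independent of t and C_{0μν}{}^ρ
= 0. The four connection terms contribute m, +1, -1 and -2 times φW, in total (m - 2) φW. -/
theorem divWeyl_zero_succ_succ (hm : 2 ≤ m) (hy : y ∈ warpedDomain I E) :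
    divWeyl (warped q H) 0 μ.succ ν.succ y = ((m : ℝ) - 2) / (m - 1)
      * (deriv q (y 0) / q (y 0)) * traceFreeRicci H μ ν (Fin.tail y) := by
  have hq := hw.q_ne_zero _ hy.1
  have hm' : (2 : ℝ) ≤ m := by exact_mod_cast hm
  have h1 : (m : ℝ) - 1 ≠ 0 := by linarith
  have hE : DifferentiableAt ℝ (traceFreeRicci H μ ν) (Fin.tail y) := by
    refine differentiableAt_of_contDiffOn hw.fibre.isOpen ?_ hy.2
    exact (hw.fibre.smooth_ricci μ ν).sub
      ((hw.fibre.smooth_scalar.div_const _).mul (hw.fibre.smooth μ ν))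
  have hp0 : pd 0 (weyl (warped q H) 0 μ.succ ν.succ 0) y = 0 := by
    rw [pd_congr hw.isOpen_domain hy fun z hz => hw.weyl_zero_succ_succ_zero μ ν hm hz]
    refine (pd_zero_separated (hasDerivAt_const (y 0) (1 / ((m : ℝ) - 1))) hE).trans ?_
    rw [zero_mul]
  have hps (σ ρ : Fin m) : pd σ.succ (weyl (warped q H) 0 μ.succ ν.succ ρ.succ) y = 0 :=
    pd_eq_zero_of_eqOn hw.isOpen_domain hy
      (fun z hz => hw.weyl_zero_succ_succ_succ μ ν hz ρ) σ.succ
  -- Trace-freeness replaces the purely spatial trace by W, so the spatial Weyl components need not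
  -- be computed.
  have htr : ∑ ρ : Fin m, weyl (warped q H) ρ.succ μ.succ ν.succ ρ.succ y
      = -weyl (warped q H) 0 μ.succ ν.succ 0 y := by
    have h := hw.isMetricOn.sum_weyl (by omega) hy μ.succ ν.succ
    rw [Fin.sum_univ_succ] at h
    linarith
  have hdd : ∑ σ : Fin m, delta σ σ = (m : ℝ) := by simp [delta]
  have hs2 (v : Fin m → ℝ) (ρ : Fin m) := sum_delta_mul v ρ
  have hL := hw.sum_metric_mul_weyl μ ν hm hy
  set W := weyl (warped q H) 0 μ.succ ν.succ 0 y with hW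
  set φ := deriv q (y 0) / q (y 0) with hφ
  have hc0 := hw.christoffel_zero_zero_zero hy
  have t1 : ∑ i : Fin (m + 1), pd i (weyl (warped q H) 0 μ.succ ν.succ i) y = 0 := by
    simp [Fin.sum_univ_succ, hp0, hps]
  have t2 : ∑ i, ∑ p, christoffel (warped q H) i i p y
      * weyl (warped q H) 0 μ.succ ν.succ p y = m * φ * W := by
    simp [Fin.sum_univ_succ, hw.weyl_zero_succ_succ_succ _ _ hy, hc0,
      hw.christoffel_succ_succ_zero _ _ hy, ← Finset.sum_mul, ← Finset.mul_sum, hdd, ← hφ, ← hW]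
    exact Or.inl (mul_comm _ _)
  have t3 : ∑ i, ∑ p, christoffel (warped q H) p i 0 y
      * weyl (warped q H) p μ.succ ν.succ i y = -(φ * W) := by
    have e (i : Fin m) : ∑ p : Fin m, φ * delta p i
        * weyl (warped q H) p.succ μ.succ ν.succ i.succ y
        = φ * weyl (warped q H) i.succ μ.succ ν.succ i.succ y := by
      rw [← hs2 (fun p => φ * weyl (warped q H) p.succ μ.succ ν.succ i.succ y) i]
      refine Finset.sum_congr rfl fun p _ => ?_
      rw [delta_comm]
      ring
    simp [Fin.sum_univ_succ, hc0, hw.christoffel_succ_succ_zero _ _ hy,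
      hw.christoffel_zero_succ_zero _ hy, hw.christoffel_succ_zero_zero _ hy, ← hφ, e,
      ← Finset.mul_sum, htr]
  have t4 : ∑ i, ∑ p, christoffel (warped q H) p i μ.succ y
      * weyl (warped q H) 0 p ν.succ i y = φ * W := by
    have e : ∑ p : Fin m, φ * delta p μ * weyl (warped q H) 0 p.succ ν.succ 0 y = φ * W := by
      rw [hW, ← hs2 (fun p => φ * weyl (warped q H) 0 p.succ ν.succ 0 y) μ]
      refine Finset.sum_congr rfl fun p _ => ?_
      rw [delta_comm]
      ring
    simp [Fin.sum_univ_succ, weyl_self, hw.christoffel_succ_zero_succ _ _ hy, ← hφ, e,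
      hw.weyl_zero_succ_succ_succ _ _ hy]
  have t5 : ∑ i, ∑ p, christoffel (warped q H) p i ν.succ y
      * weyl (warped q H) 0 μ.succ p i y = 2 * (φ * W) := by
    have e : ∑ p : Fin m, φ * delta p ν * weyl (warped q H) 0 μ.succ p.succ 0 y = φ * W := by
      rw [hW, ← hs2 (fun p => φ * weyl (warped q H) 0 μ.succ p.succ 0 y) ν]
      refine Finset.sum_congr rfl fun p _ => ?_
      rw [delta_comm]
      ring
    have e' : ∑ i : Fin m, q (y 0) * deriv q (y 0) * H (Fin.tail y) i ν
        * weyl (warped q H) 0 μ.succ 0 i.succ y = φ * W := by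
      simp only [mul_assoc, ← Finset.mul_sum]
      rw [hL, hW, hw.weyl_zero_succ_succ_zero _ _ hm hy, hφ]
      field_simp
    simp [Fin.sum_univ_succ, hw.christoffel_zero_zero_succ _ hy,
      hw.christoffel_zero_succ_succ _ _ hy, hw.christoffel_succ_zero_succ _ _ hy, ← hφ, e, e',
      hw.weyl_zero_succ_succ_succ _ _ hy]
    ring
  simp only [divWeyl, Finset.sum_add_distrib, Finset.sum_sub_distrib]
  rw [t1, t2, t3, t4, t5, hW, hw.weyl_zero_succ_succ_zero _ _ hm hy]
  field_simp
  ring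

/-- A warped product with divergence-free Weyl tensor and nonconstant scale factor has an
Einstein fibre. -/
theorem ricci_fibre_eq (hm : 3 ≤ m) (hdiv : ∀ y ∈ warpedDomain I E, ∀ j k l,
    divWeyl (warped q H) j k l y = 0) {t : ℝ} (ht : t ∈ I) (hq' : deriv q t ≠ 0) {x : Coord m}
    (hx : x ∈ E) : ricci H μ ν x = scalar H x / m * H x μ ν := by
  have hm' : (3 : ℝ) ≤ m := by exact_mod_cast hm
  -- One instant with q' ≠ 0 serves all x, because the trace-free Ricci tensor of the fibre does not
  -- see t.
  have hy : (Fin.cons t x : Coord (m + 1)) ∈ warpedDomain I E := ⟨ht, hx⟩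
  have h := hw.divWeyl_zero_succ_succ μ ν (by omega) hy
  rw [hdiv _ hy] at h
  have hc : ((m : ℝ) - 2) / (m - 1) * (deriv q t / q t) ≠ 0 :=
    mul_ne_zero (div_ne_zero (by linarith) (by linarith))
      (div_ne_zero hq' (hw.q_ne_zero t ht))
  exact sub_eq_zero.1 ((mul_eq_zero.1 h.symm).resolve_left hc)

theorem pd_succ_scalar_eq_zero (hm : 3 ≤ m) (hdiv : ∀ y ∈ warpedDomain I E, ∀ j k l,
    divWeyl (warped q H) j k l y = 0) {t : ℝ} (ht : t ∈ I) (hq' : deriv q t ≠ 0)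
    (hy : y ∈ warpedDomain I E) : pd μ.succ (scalar (warped q H)) y = 0 := by
  have hs := hw.fibre.pd_scalar_eq_zero_of_einstein hm
    (fun x hx a b => hw.ricci_fibre_eq a b hm hdiv ht hq' hx) hy.2 μ
  have hO := hw.isOpen_domain
  have hR : DifferentiableAt ℝ (scalar (warped q H)) y :=
    differentiableAt_of_contDiffOn hO hw.isMetricOn.smooth_scalar hy
  have hq := hw.q_ne_zero _ hy.1
  -- Multiplying by q² splits R into a function of x plus a function of t. The first has zero
  -- derivative by Schur's lemma; the others are differentiated as a(t) · 1.
  have e : ∀ z ∈ warpedDomain I E, q (z 0) ^ 2 * scalar (warped q H) z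
      = scalar H (Fin.tail z) + (m * (m - 1) * deriv q (z 0) ^ 2
        + 2 * m * (q (z 0) * deriv (deriv q) (z 0))) := by
    intro z hz
    have hq := hw.q_ne_zero _ hz.1
    rw [hw.scalar_eq hz]
    field_simp
    ring
  have hq2 : HasDerivAt (fun t => deriv (deriv q) t) (deriv (deriv (deriv q)) (y 0)) (y 0) :=
    ((((hw.smooth_q.deriv_of_isOpen hw.isOpen_I (m := ∞) (by simp)).deriv_of_isOpen
      hw.isOpen_I (m := ∞) (by simp)).contDiffAt
      (hw.isOpen_I.mem_nhds hy.1)).differentiableAt (by simp)).hasDerivAt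
  have h1 := (hw.hasDerivAt_q hy.1).fun_pow 2
  have h2 := (((hw.hasDerivAt_deriv_q hy.1).fun_pow 2).const_mul ((m : ℝ) * (m - 1))).fun_add
    (((hw.hasDerivAt_q hy.1).fun_mul hq2).const_mul (2 * (m : ℝ)))
  have hsd := differentiableAt_of_contDiffOn hw.fibre.isOpen hw.fibre.smooth_scalar hy.2
  have p1 := pd_succ_separated (F := fun _ => (1 : ℝ)) h1 (differentiableAt_const _) μ
  have p2 := pd_succ_separated (F := fun _ => (1 : ℝ)) h2 (differentiableAt_const _) μ
  have p3 := pd_succ_separated (hasDerivAt_const (y 0) (1 : ℝ)) hsd μ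
  have d1 := (hasFDerivAt_separated (F := fun _ => (1 : ℝ)) h1
    (differentiableAt_const _)).differentiableAt
  have d2 := (hasFDerivAt_separated (F := fun _ => (1 : ℝ)) h2
    (differentiableAt_const _)).differentiableAt
  have d3 := (hasFDerivAt_separated (hasDerivAt_const (y 0) (1 : ℝ)) hsd).differentiableAt
  simp only [mul_one, one_mul, pd_const, mul_zero, hs] at p1 p2 p3 d1 d2 d3
  have h := pd_congr hO hy e μ.succ
  rw [pd_mul _ d1 hR, pd_add _ d3 d2, p1, p2, p3, zero_mul, zero_add, zero_add] at h
  exact (mul_eq_zero.1 h).resolve_left (pow_ne_zero 2 hq)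

end IsWarpedOn

end WarpedWeyl

/-! ### Torse-forming velocity, Hessians of time-dependent scalars, stress-energy -/

section WarpedHessian

variable {m : ℕ}

theorem dot_single {n : ℕ} (i : Fin n) (F : Coord n → ℝ) :
    dot (fun _ => Pi.single i 1) F = pd i F := by
  ext y
  simp [dot, Pi.single_apply]

theorem lower_single_zero (q : ℝ → ℝ) (H : MetricComp m) :
    lower (warped q H) (fun _ => Pi.single 0 1) = fun k _ => if k = 0 then -1 else 0 := by
  ext k y
  refine Fin.cases ?_ (fun μ => ?_) k <;>
    simp [lower, Pi.single_apply, warped_zero_zero, warped_succ_zero]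

/-- Chain rule for the partial derivatives of `F ∘ S`. -/
theorem pd_comp {n : ℕ} {F : ℝ → ℝ} {S : Coord n → ℝ} {y : Coord n}
    (hF : DifferentiableAt ℝ F (S y)) (hS : DifferentiableAt ℝ S y) (i : Fin n) :
    pd i (fun z => F (S z)) y = deriv F (S y) * pd i S y := by
  have h := hF.hasDerivAt.comp_hasFDerivAt y hS.hasFDerivAt
  rw [pd, show (fun z => F (S z)) = F ∘ S from rfl, h.fderiv]
  simp [pd]

namespace IsWarpedOn

variable {q : ℝ → ℝ} {H : MetricComp m} {I : Set ℝ} {E : Set (Coord m)}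
  (hw : IsWarpedOn q H I E) {y : Coord (m + 1)} (μ ν : Fin m)

include hw

theorem covD_lower_single_zero (hy : y ∈ warpedDomain I E) (k l : Fin (m + 1)) :
    covD (warped q H) (lower (warped q H) (fun _ => Pi.single 0 1)) k l y
      = deriv q (y 0) / q (y 0) * (warped q H y k l
        + lower (warped q H) (fun _ => Pi.single 0 1) k y
          * lower (warped q H) (fun _ => Pi.single 0 1) l y) := by
  have hq := hw.q_ne_zero _ hy.1
  simp only [lower_single_zero, covD, pd_const]
  refine Fin.cases ?_ (fun μ => ?_) k <;> refine Fin.cases ?_ (fun ν => ?_) l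
  · simp [hw.christoffel_zero_zero_zero hy, warped_zero_zero]
  · simp [hw.christoffel_zero_zero_succ _ hy, warped_zero_succ]
  · simp [hw.christoffel_zero_succ_zero _ hy, warped_succ_zero]
  · simp [hw.christoffel_zero_succ_succ _ _ hy, warped_succ_succ]
    field_simp

variable {S : Coord (m + 1) → ℝ}

theorem hess_zero_zero (hy : y ∈ warpedDomain I E) :
    hess (warped q H) S 0 0 y = pd 0 (pd 0 S) y := by
  simp [hess, covD, Fin.sum_univ_succ, hw.christoffel_zero_zero_zero hy,
    hw.christoffel_succ_zero_zero _ hy]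

theorem hess_zero_succ (hS : ∀ z ∈ warpedDomain I E, ∀ μ : Fin m, pd μ.succ S z = 0)
    (hy : y ∈ warpedDomain I E) : hess (warped q H) S 0 μ.succ y = 0 := by
  simp [hess, covD, Fin.sum_univ_succ, hw.christoffel_zero_zero_succ _ hy, hS y hy,
    pd_eq_zero_of_eqOn hw.isOpen_domain hy fun z hz => hS z hz μ]

/-- Unlike the (0, μ) entry, this one contains ∂_μ ∂_0 S, so smoothness is needed to exchange the
derivatives. -/
theorem hess_succ_zero (hSm : ContDiffOn ℝ ∞ S (warpedDomain I E))
    (hS : ∀ z ∈ warpedDomain I E, ∀ μ : Fin m, pd μ.succ S z = 0)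
    (hy : y ∈ warpedDomain I E) : hess (warped q H) S μ.succ 0 y = 0 := by
  simp [hess, covD, Fin.sum_univ_succ, hw.christoffel_zero_succ_zero _ hy, hS y hy,
    pd_comm hw.isOpen_domain hSm hy μ.succ 0,
    pd_eq_zero_of_eqOn hw.isOpen_domain hy fun z hz => hS z hz μ]

/-- Only -Γ^0_{μν} ∂_0 S remains, and Γ^0_{μν} = q q' h_{μν} = φ g_{μν}. -/
theorem hess_succ_succ (hS : ∀ z ∈ warpedDomain I E, ∀ μ : Fin m, pd μ.succ S z = 0)
    (hy : y ∈ warpedDomain I E) : hess (warped q H) S μ.succ ν.succ y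
      = -(deriv q (y 0) / q (y 0) * pd 0 S y * warped q H y μ.succ ν.succ) := by
  have hq := hw.q_ne_zero _ hy.1
  simp [hess, covD, Fin.sum_univ_succ, hw.christoffel_zero_succ_succ _ _ hy, hS y hy,
    pd_eq_zero_of_eqOn hw.isOpen_domain hy fun z hz => hS z hz ν, warped_succ_succ]
  field_simp

theorem box_eq (hS : ∀ z ∈ warpedDomain I E, ∀ μ : Fin m, pd μ.succ S z = 0)
    (hy : y ∈ warpedDomain I E) : box (warped q H) S y
      = -pd 0 (pd 0 S) y - m * (deriv q (y 0) / q (y 0)) * pd 0 S y := by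
  have hq := hw.q_ne_zero _ hy.1
  have h := hw.fibre.sum_inv_mul_self hy.2
  have e : ∑ μ : Fin m, ∑ ν : Fin m,
      (warped q H y)⁻¹ μ.succ ν.succ * hess (warped q H) S μ.succ ν.succ y
      = -(deriv q (y 0) / q (y 0) * pd 0 S y)
        * ∑ k, ∑ l, (H (Fin.tail y))⁻¹ k l * H (Fin.tail y) k l := by
    simp only [hw.inv_succ_succ _ _ hy, hw.hess_succ_succ _ _ hS hy, warped_succ_succ,
      Finset.mul_sum]
    refine Finset.sum_congr rfl fun k _ => Finset.sum_congr rfl fun l _ => ?_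
    field_simp
  simp only [box, Fin.sum_univ_succ (n := m), hw.inv_zero_succ _ hy, hw.inv_succ_zero _ hy,
    zero_mul, zero_add, Finset.sum_const_zero, add_zero]
  rw [e, h, hw.inv_zero_zero hy, hw.hess_zero_zero hy]
  ring

/-- If the curvature scalar of a warped product with Einstein fibre depends on time only, the
stress-energy tensor of `f(R)` gravity is that of a perfect fluid. -/
theorem stressEnergy_eq (hm : 1 ≤ m)
    (hE : ∀ μ ν, ∀ x ∈ E, ricci H μ ν x = scalar H x / m * H x μ ν)
    (hR : ∀ z ∈ warpedDomain I E, ∀ μ : Fin m, pd μ.succ (scalar (warped q H)) z = 0)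
    {κ : ℝ} {f : ℝ → ℝ} {U : Set ℝ} (hU : IsOpen U) (hf : ContDiffOn ℝ ∞ f U)
    (hRU : ∀ z ∈ warpedDomain I E, scalar (warped q H) z ∈ U)
    (hy : y ∈ warpedDomain I E) {φ ξ P ϱ : ℝ}
    (hφ : φ = deriv q (y 0) / q (y 0)) (hξ : ξ = m * (deriv (deriv q) (y 0) / q (y 0)))
    (hP : P = κ⁻¹ * (-(1 / 2) * f (scalar (warped q H) y)
      + (scalar (warped q H) y - ξ) / m * deriv f (scalar (warped q H) y)
      - ((m - 1) * φ * pd 0 (scalar (warped q H)) y + pd 0 (pd 0 (scalar (warped q H))) y)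
        * iteratedDeriv 2 f (scalar (warped q H) y)
      - pd 0 (scalar (warped q H)) y ^ 2 * iteratedDeriv 3 f (scalar (warped q H) y)))
    (hϱ : ϱ = κ⁻¹ * ((1 / 2) * f (scalar (warped q H) y) - ξ * deriv f (scalar (warped q H) y)
      + m * φ * pd 0 (scalar (warped q H)) y * iteratedDeriv 2 f (scalar (warped q H) y)))
    (k l : Fin (m + 1)) :
    stressEnergy κ f (warped q H) k l y
      = (ϱ + P) * (lower (warped q H) (fun _ => Pi.single 0 1) k y
          * lower (warped q H) (fun _ => Pi.single 0 1) l y) + P * warped q H y k l := by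
  have hm' : (1 : ℝ) ≤ m := by exact_mod_cast hm
  have hm0 : (m : ℝ) ≠ 0 := by linarith
  have hq := hw.q_ne_zero _ hy.1
  have hO := hw.isOpen_domain
  have hsc := hw.isMetricOn.smooth_scalar
  have hf1 : ContDiffOn ℝ ∞ (deriv f) U := hf.deriv_of_isOpen hU (by simp)
  have hf2 : ContDiffOn ℝ ∞ (deriv (deriv f)) U := hf1.deriv_of_isOpen hU (by simp)
  have hd {g : ℝ → ℝ} (hg : ContDiffOn ℝ ∞ g U) {z} (hz : z ∈ warpedDomain I E) :
      DifferentiableAt ℝ g (scalar (warped q H) z) :=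
    (hg.contDiffAt (hU.mem_nhds (hRU z hz))).differentiableAt (by simp)
  have hsd {z} (hz : z ∈ warpedDomain I E) := differentiableAt_of_contDiffOn hO hsc hz
  have hSm : ContDiffOn ℝ ∞ (fun z => deriv f (scalar (warped q H) z)) (warpedDomain I E) :=
    hf1.comp hsc hRU
  have hS (z) (hz : z ∈ warpedDomain I E) (μ : Fin m) :
      pd μ.succ (fun z => deriv f (scalar (warped q H) z)) z = 0 := by
    rw [pd_comp (hd hf1 hz) (hsd hz), hR z hz, mul_zero]
  have i2 : iteratedDeriv 2 f = deriv (deriv f) := by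
    rw [iteratedDeriv_succ, iteratedDeriv_one]
  have i3 : iteratedDeriv 3 f = deriv (deriv (deriv f)) := by
    rw [iteratedDeriv_succ, i2]
  have hS1 : pd 0 (fun z => deriv f (scalar (warped q H) z)) y
      = deriv (deriv f) (scalar (warped q H) y) * pd 0 (scalar (warped q H)) y :=
    pd_comp (hd hf1 hy) (hsd hy) 0
  have hS2 : pd 0 (pd 0 (fun z => deriv f (scalar (warped q H) z))) y
      = deriv (deriv (deriv f)) (scalar (warped q H) y) * pd 0 (scalar (warped q H)) y ^ 2
        + deriv (deriv f) (scalar (warped q H) y) * pd 0 (pd 0 (scalar (warped q H))) y := by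
    rw [pd_congr hO hy (fun z hz => pd_comp (hd hf1 hz) (hsd hz) 0) 0,
      pd_mul (F := fun z => deriv (deriv f) (scalar (warped q H) z)) 0
        (differentiableAt_of_contDiffOn hO (hf2.comp hsc hRU) hy)
        (differentiableAt_of_contDiffOn hO (ContDiffOn.pd hO hsc 0) hy),
      pd_comp (hd hf2 hy) (hsd hy) 0]
    ring
  have hb := hw.box_eq hS hy
  rw [hS1, hS2] at hb
  -- The Einstein condition makes the spatial Ricci block a multiple of g; since R_{00} = -ξ, the
  -- trace fixes the factor as (R - ξ)/m.
  have hric (μ ν : Fin m) : ricci (warped q H) μ.succ ν.succ y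
      = (scalar (warped q H) y - ξ) / m * warped q H y μ.succ ν.succ := by
    rw [hw.ricci_succ_succ _ _ hy, hE μ ν _ hy.2, hw.scalar_eq hy, warped_succ_succ, hξ]
    field_simp
    ring
  rw [stressEnergy, hb, lower_single_zero, hP, hϱ, i2, i3]
  refine Fin.cases ?_ (fun μ => ?_) k <;> refine Fin.cases ?_ (fun ν => ?_) l
  -- The (0, 0) component is the density. The second time derivative of f'(R) cancels between the
  -- d'Alembertian and the Hessian, so neither R̈ nor f''' occurs in it.
  · rw [hw.hess_zero_zero hy, hS2, hw.ricci_zero_zero hy, warped_zero_zero, ← hξ, ← hφ]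
    simp only [if_true]
    ring
  · rw [hw.hess_zero_succ _ hS hy, hw.ricci_zero_succ _ hy, warped_zero_succ]
    simp
  · rw [hw.hess_succ_zero _ hSm hS hy, hw.ricci_succ_zero _ hy, warped_succ_zero]
    simp
  -- The spatial block is the pressure. Subtracting the Hessian turns the coefficient m of φ in the
  -- d'Alembertian into m - 1 = n - 2.
  · rw [hw.hess_succ_succ _ _ hS hy, hS1, hric, ← hφ]
    simp only [Fin.succ_ne_zero, if_false]
    ring

end IsWarpedOn

end WarpedHessian

/-! ### From the space-time to warped products in charts -/

namespace SpaceTime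

variable {m : ℕ} {S : Type*} [TopologicalSpace S]
    [ChartedSpace (EuclideanSpace ℝ (Fin m)) S] [IsManifold (𝓡 m) ∞ S]

/-- The components of the fibre metric in a chart, as a function on coordinate space. -/
def fibreMetric (M : SpaceTime m S) (e : OpenPartialHomeomorph S (EuclideanSpace ℝ (Fin m))) :
    MetricComp m := fun x => Matrix.of (M.fibreComp e (WithLp.toLp 2 x))

/-- The range of a chart of the fibre, as a subset of coordinate space. -/
def fibreDomain (e : OpenPartialHomeomorph S (EuclideanSpace ℝ (Fin m))) : Set (Coord m) :=
  {x | WithLp.toLp 2 x ∈ e.target}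

theorem metric_eq_warped (M : SpaceTime m S)
    (e : OpenPartialHomeomorph S (EuclideanSpace ℝ (Fin m))) :
    M.metric e = warped M.q (M.fibreMetric e) := rfl

theorem isWarpedOn (M : SpaceTime m S)
    {e : OpenPartialHomeomorph S (EuclideanSpace ℝ (Fin m))} (he : e ∈ M.charts) :
    IsWarpedOn M.q (M.fibreMetric e) M.I (fibreDomain e) where
  isOpen_I := M.isOpen_I
  smooth_q := M.contDiffOn_q
  q_ne_zero t ht := (M.q_pos t ht).ne'
  fibre :=
    { isOpen := e.open_target.preimage (PiLp.continuous_toLp 2 _)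
      smooth := fun μ ν => (M.contDiffOn_fibreComp he μ ν).comp
        (PiLp.contDiff_toLp (p := 2)).contDiffOn fun _ hx => hx
      symm := fun _ μ ν => M.fibreComp_symm e _ μ ν
      det_ne_zero := fun _ hx => M.det_fibreComp_ne_zero he hx }

/-- A nonconstant scale factor has a nonzero derivative somewhere. -/
theorem exists_deriv_ne_zero (M : SpaceTime m S) (hq : ∃ s ∈ M.I, ∃ t ∈ M.I, M.q s ≠ M.q t) :
    ∃ t ∈ M.I, deriv M.q t ≠ 0 := by
  by_contra! h
  obtain ⟨s, hs, t, ht, hst⟩ := hq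
  exact hst (M.isOpen_I.is_const_of_deriv_eq_zero M.ordConnected_I.isPreconnected
    (M.contDiffOn_q.differentiableOn (by simp)) h hs ht)

end SpaceTime

end GRW

end

/-! ### The perfect-fluid theorem -/

theorem theorem3p3 (n m : ℕ) (hnm : n = m + 1) (hn : 4 ≤ n)
    {S : Type*} [TopologicalSpace S] [ChartedSpace (EuclideanSpace ℝ (Fin m)) S]
    [IsManifold (𝓡 m) ∞ S] (M : GRW.SpaceTime m S)
    (hq : ∃ s ∈ M.I, ∃ t ∈ M.I, M.q s ≠ M.q t)
    (hW : M.HarmonicWeyl)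
    (κ : ℝ) (hκ : κ ≠ 0)
    (f : ℝ → ℝ) (U : Set ℝ) (hU : IsOpen U) (hf : ContDiffOn ℝ ∞ f U)
    (hRU : ∀ e ∈ M.charts, ∀ y ∈ M.domain e, GRW.scalar (M.metric e) y ∈ U) :
    ∀ e ∈ M.charts, ∃ φ ξ p μ : GRW.Coord (m + 1) → ℝ, ∀ y ∈ M.domain e,
      let G := M.metric e
      let u := M.velocity
      let R := GRW.scalar G
      let R' := GRW.dot u R y
      let R'' := GRW.dot u (GRW.dot u R) y
      -- `u` is torse-forming, `∇_k u_l = φ (g_{kl} + u_k u_l)`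
      (∀ k l, GRW.covD G (GRW.lower G u) k l y
        = φ y * (G y k l + GRW.lower G u k y * GRW.lower G u l y)) ∧
      -- `u` is an eigenvector of the Ricci tensor, `R_{ij} u^j = ξ u_i`
      (∀ i, ∑ j, GRW.ricci G i j y * u y j = ξ y * GRW.lower G u i y) ∧
      -- the stress-energy tensor is that of a perfect fluid
      (∀ k l, GRW.stressEnergy κ f G k l y
        = (μ y + p y) * (GRW.lower G u k y * GRW.lower G u l y) + p y * G y k l) ∧
      -- pressure
      κ * p y = -(1 / 2) * f (R y) + (R y - ξ y) / ((n : ℝ) - 1) * deriv f (R y)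
        - (((n : ℝ) - 2) * φ y * R' + R'') * iteratedDeriv 2 f (R y)
        - R' ^ 2 * iteratedDeriv 3 f (R y) ∧
      -- energy density
      κ * μ y = (1 / 2) * f (R y) - ξ y * deriv f (R y)
        + ((n : ℝ) - 1) * φ y * R' * iteratedDeriv 2 f (R y) := by
  subst hnm
  intro e he
  have hw := M.isWarpedOn he
  have hn1 : ((m + 1 : ℕ) : ℝ) - 1 = m := by push_cast; ring
  have hn2 : ((m + 1 : ℕ) : ℝ) - 2 = m - 1 := by push_cast; ring
  obtain ⟨t, ht, hqt⟩ := M.exists_deriv_ne_zero hq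
  have hE := fun μ ν x hx => hw.ricci_fibre_eq (x := x) μ ν (by omega) (hW e he) ht hqt hx
  have hR := fun z hz μ => hw.pd_succ_scalar_eq_zero (y := z) μ (by omega) (hW e he) ht hqt hz
  -- φ is the Hubble rate q'/q. The value of ξ is forced by R_{00} = -m q''/q together with u_0 =
  -- -1.
  let φ : GRW.Coord (m + 1) → ℝ := fun y => deriv M.q (y 0) / M.q (y 0)
  let ξ : GRW.Coord (m + 1) → ℝ := fun y => m * (deriv (deriv M.q) (y 0) / M.q (y 0))
  let R := GRW.scalar (M.metric e)
  refine ⟨φ, ξ,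
    fun y => κ⁻¹ * (-(1 / 2) * f (R y) + (R y - ξ y) / m * deriv f (R y)
      - ((m - 1) * φ y * GRW.pd 0 R y + GRW.pd 0 (GRW.pd 0 R) y) * iteratedDeriv 2 f (R y)
      - GRW.pd 0 R y ^ 2 * iteratedDeriv 3 f (R y)),
    fun y => κ⁻¹ * ((1 / 2) * f (R y) - ξ y * deriv f (R y)
      + m * φ y * GRW.pd 0 R y * iteratedDeriv 2 f (R y)), fun y hy => ?_⟩
  have hu : M.velocity = fun _ => Pi.single 0 1 := rfl
  simp only [hu, GRW.dot_single, hn1, hn2]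
  refine ⟨hw.covD_lower_single_zero hy, fun i => ?_, hw.stressEnergy_eq (by omega) hE hR hU hf
    (hRU e he) hy rfl rfl rfl rfl, mul_inv_cancel_left₀ hκ _, mul_inv_cancel_left₀ hκ _⟩
  rw [GRW.SpaceTime.metric_eq_warped, GRW.lower_single_zero]
  refine Fin.cases ?_ (fun μ => ?_) i
  · simp [Pi.single_apply, hw.ricci_zero_zero hy, ξ]
  · simp [Pi.single_apply, hw.ricci_succ_zero _ hy]
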